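/- Let $n,m,k$ be positive integers. Let $S\in\mathbb Z^{(2k,2k)}$ be a symmetric, positive definite, even (all diagonal entries even), unimodular integral matrix of size $2k$, and let $c\in\mathbb Z^{(2k,m)}$ be an integral $2k\times m$ matrix such that ${}^tcSc$ is positive definite. Let $P$ be a homogeneous complex polynomial in the entries $W_{pi}$ ($1\le p\le m$, $1\le i\le n$) of an $m\times n$ matrix $W$ which is pluriharmonic with respect to $({}^tcSc)^{-1}$, i.e., with $(t_{pq})={}^tcSc$, $$\sum_{p,q=1}^m t_{pq}\,\frac{\partial^2 P}{\partial W_{pi}\,\partial W_{qj}}=0\qquad(1\le i,j\le n).$$ Let $\Gamma_n=Sp(n,\mathbb Z)$ be the Siegel modular group and $H_n$ the set of complex symmetric $n\times n$ matrices with positive definite imaginary part; $\sigma$ denotes the trace. Then for every $M=\begin{pmatrix}A&B\\ C&D\end{pmatrix}\in\Gamma_n$ (with $n\times n$ blocks) and every $Z\in H_n$ the matrix $CZ+D$ is invertible, both series below converge absolutely, and $$\sum_{\lambda\in\mathbb Z^{(2k,n)}}P\bigl(2\pi i\,{}^tcS\lambda\,{}^t(CZ+D)^{-1}\bigr)\,e^{\pi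 i\,\sigma(S\lambda(AZ+B)(CZ+D)^{-1}\,{}^t\lambda)} =\det(CZ+D)^k\sum_{\lambda\in\mathbb Z^{(2k,n)}}P\bigl(2\pi i\,{}^tcS\lambda\bigr)\,e^{\pi i\,\sigma(S\lambda Z\,{}^t\lambda)}.$$ -/

import Mathlib

open scoped Matrix

noncomputable section

/-- The Siegel upper half plane of degree `n`: complex symmetric `n × n` matrices whose
imaginary part is positive definite. -/
def SiegelUpperHalf (n : ℕ) : Set (Matrix (Fin n) (Fin n) ℂ) :=
  {Z | Zᵀ = Z ∧ (Z.map Complex.im).PosDef}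

/-- An integral matrix regarded as a complex matrix. -/
def intToComplex {l r : Type*} (A : Matrix l r ℤ) : Matrix l r ℂ :=
  A.map (fun a : ℤ => (a : ℂ))

/-- The factor `C Z + D` of an integral block matrix `M = (A B; C D)`. -/
def siegelDenom {n : ℕ} (M : Matrix (Fin n ⊕ Fin n) (Fin n ⊕ Fin n) ℤ)
    (Z : Matrix (Fin n) (Fin n) ℂ) : Matrix (Fin n) (Fin n) ℂ :=
  intToComplex M.toBlocks₂₁ * Z + intToComplex M.toBlocks₂₂

/-- The factor `A Z + B` of an integral block matrix `M = (A B; C D)`. -/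
def siegelNum {n : ℕ} (M : Matrix (Fin n ⊕ Fin n) (Fin n ⊕ Fin n) ℤ)
    (Z : Matrix (Fin n) (Fin n) ℂ) : Matrix (Fin n) (Fin n) ℂ :=
  intToComplex M.toBlocks₁₁ * Z + intToComplex M.toBlocks₁₂

/-- The value of a polynomial in the entries `W p i` of an `m × n` matrix at the matrix `W`. -/
def evalMatrix {m n : ℕ} (P : MvPolynomial (Fin m × Fin n) ℂ) (W : Matrix (Fin m) (Fin n) ℂ) : ℂ :=
  MvPolynomial.eval (fun x => W x.1 x.2) P

/-- The operator `Δ_{i,j} = ∑_{p,q} t_{pq} ∂² / ∂W_{pi} ∂W_{qj}` attached to a rational matrix `S`,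
where `(t_{pq})` is the inverse of `S`. -/
def pluriLaplacian {m n : ℕ} (S : Matrix (Fin m) (Fin m) ℚ) (i j : Fin n)
    (P : MvPolynomial (Fin m × Fin n) ℂ) : MvPolynomial (Fin m × Fin n) ℂ :=
  ∑ p : Fin m, ∑ q : Fin m,
    ((S⁻¹ p q : ℚ) : ℂ) • MvPolynomial.pderiv (p, i) (MvPolynomial.pderiv (q, j) P)

/-- `P` is pluriharmonic with respect to `S`. -/
def IsPluriharmonic {m n : ℕ} (S : Matrix (Fin m) (Fin m) ℚ)
    (P : MvPolynomial (Fin m × Fin n) ℂ) : Prop :=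
  ∀ i j : Fin n, pluriLaplacian S i j P = 0

/-- A symmetric integral matrix that is positive definite, unimodular and even. -/
structure IsEvenUnimodularPosDef {r : ℕ} (S : Matrix (Fin r) (Fin r) ℤ) : Prop where
  posDef : (S.map (fun a : ℤ => (a : ℝ))).PosDef
  unimodular : IsUnit S.det
  even : ∀ i, Even (S i i)

end

/-!
Write `θ(Z)` for the theta series of `S` with coefficient function `Q(L) = P(2πi cᵀ S L)`. The
factor `C Z + D` satisfies a cocycle relation, so the identity for `M₁` and `M₂` implies it for
`M₁ M₂` (`ThetaLaw.mul`), provided that all coefficient functions `Q(L R)` are treated at once. It is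
therefore enough to prove it for generators of `Sp(n, ℤ)`: translations `Z ↦ Z + B`, their lower
triangular conjugates, and the block diagonal matrices `Z ↦ U Z Uᵀ`.

*Generation* (`symplecticGroup_le_of_generators`). If `det A ≠ 0`, subtracting nearest integers from
the symmetric matrix `C A⁻¹` leaves a symmetric remainder `R` with entries at most `1/2` in absolute
value. If `R ≠ 0`, inverting in one or two coordinates multiplies `det A` by `-R i i` or by `R i j ^ 2`,
which is Euclidean descent; if `R = 0`, the matrix is a product of generators. The condition
`det A ≠ 0` is reached by a translation, because `det (A + t C)` does not vanish at `t = i`.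

*Inversion.* The inversion formula for the general Riemann theta series with matrix `Ω` is obtained one
coordinate at a time: the one-variable functional equation of `jacobiTheta₂` is applied to one
coordinate, and the remaining series has the Schur complement as its matrix
(`IsInversionFactor.fromBlocks`). The factor produced in this way is a continuous square root of
`det (-i Ω)` (`hasContinuousInversionFactor`). For `Ω = S ⊗ Z` with `S` unimodular of size `2k` it is
hence, up to sign, `det (-i Z) ^ k`; the sign is constant because the Siegel space is convex, and it is
`1` because the inversion fixes `Z = i`, where the theta series is positive
(`isInversionFactor_kronecker`). The constant `(-i) ^ (n k)` is trivial by the relation of order three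
between `Z ↦ -Z⁻¹` and `Z ↦ Z + 1`, the latter leaving the theta series invariant because `S` is even
(`neg_I_pow_eq_one`). The case `n = 1` shows that `k` is even, so that the factor `det U ^ k` of the
block diagonal matrices is trivial as well.

*Coefficients.* The polynomial `P` is a combination of `d`-th powers of linear forms
(`MvPolynomial.IsHomogeneous.mem_linFormPowSpan`). Applying the pluriharmonic operators repeatedly to
this combination gives relations between lower powers
(`sum_symbol_pow_mul_linForm_pow_eq_zero`). Inserting a variable `t w` in the inversion formula, for
each of the linear forms `w`, and comparing the coefficients of `t ^ d` gives the transformation law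
with coefficients `P`: the Gaussian factor `exp (π i t² tr (S⁻¹ w Z⁻¹ wᵀ))` would contribute further
terms, but they are exactly the relations just mentioned
(`IsPluriharmonicPowerSum.tsum_neg_inv`).
-/

open scoped Kronecker

/-! ### The Siegel upper half space -/

/-- The Siegel upper half space over an arbitrary finite index type. -/
def IsSiegel {ι : Type*} (Ω : Matrix ι ι ℂ) : Prop :=
  Ωᵀ = Ω ∧ (Ω.map Complex.im).PosDef

namespace IsSiegel

variable {ι ι₁ ι₂ : Type*} [Fintype ι] [Fintype ι₁] [Fintype ι₂]

theorem im_ofReal_form (Ω : Matrix ι ι ℂ) (x : ι → ℝ) :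
    ((Complex.ofReal ∘ x) ⬝ᵥ Ω *ᵥ (Complex.ofReal ∘ x)).im = x ⬝ᵥ (Ω.map Complex.im) *ᵥ x := by
  simp [dotProduct, Matrix.mulVec]

theorem of_im_pos {Ω : Matrix ι ι ℂ} (hs : Ωᵀ = Ω)
    (h : ∀ x : ι → ℝ, x ≠ 0 → 0 < ((Complex.ofReal ∘ x) ⬝ᵥ Ω *ᵥ (Complex.ofReal ∘ x)).im) :
    IsSiegel Ω := by
  refine ⟨hs, Matrix.PosDef.of_dotProduct_mulVec_pos ?_ fun x hx => ?_⟩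
  · ext i j
    simpa using congrArg Complex.im (congrFun (congrFun hs i) j)
  · simpa [im_ofReal_form] using h x hx

/-- The Hermitian form of a point of the Siegel space has positive imaginary part, since the
symmetric real part contributes only a real number. -/
theorem im_star_form_pos {Ω : Matrix ι ι ℂ} (h : IsSiegel Ω) {z : ι → ℂ} (hz : z ≠ 0) :
    0 < (star z ⬝ᵥ Ω *ᵥ z).im := by
  have key : (star z ⬝ᵥ Ω *ᵥ z).im =
      (fun i => (z i).re) ⬝ᵥ (Ω.map Complex.im) *ᵥ (fun i => (z i).re) +
      (fun i => (z i).im) ⬝ᵥ (Ω.map Complex.im) *ᵥ (fun i => (z i).im) := by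
    have hcross : ∑ i, ∑ j, (z i).re * ((Ω i j).re * (z j).im) =
        ∑ i, ∑ j, (z i).im * ((Ω i j).re * (z j).re) := by
      rw [Finset.sum_comm]
      refine Finset.sum_congr rfl fun i _ => Finset.sum_congr rfl fun j _ => ?_
      have : Ω j i = Ω i j := congrFun (congrFun h.1 i) j
      rw [this]; ring
    simp only [dotProduct, Matrix.mulVec, Pi.star_apply, Complex.im_sum, Finset.mul_sum,
      Matrix.map_apply, ← Finset.sum_add_distrib]
    rw [← sub_eq_zero, ← Finset.sum_sub_distrib]
    have := sub_eq_zero.mpr hcross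
    rw [← this, ← Finset.sum_sub_distrib]
    refine Finset.sum_congr rfl fun i _ => ?_
    rw [← Finset.sum_sub_distrib, ← Finset.sum_sub_distrib]
    refine Finset.sum_congr rfl fun j _ => ?_
    simp
    ring
  rw [key]
  by_cases hre : (fun i => (z i).re) = 0
  · have him : (fun i => (z i).im) ≠ 0 := by
      intro him
      apply hz
      ext i
      exact Complex.ext (congrFun hre i) (congrFun him i)
    have h2 := h.2.dotProduct_mulVec_pos him
    have h1 := h.2.posSemidef.dotProduct_mulVec_nonneg (fun i => (z i).re)
    simp only [star_trivial] at h1 h2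
    linarith
  · have h1 := h.2.dotProduct_mulVec_pos hre
    have h2 := h.2.posSemidef.dotProduct_mulVec_nonneg (fun i => (z i).im)
    simp only [star_trivial] at h1 h2
    linarith

theorem isUnit_det [DecidableEq ι] {Ω : Matrix ι ι ℂ} (h : IsSiegel Ω) : IsUnit Ω.det := by
  rw [isUnit_iff_ne_zero]
  intro h0
  obtain ⟨z, hz, hz0⟩ := Matrix.exists_mulVec_eq_zero_iff.mpr h0
  have := h.im_star_form_pos hz
  simp [hz0] at this

theorem submatrix {α β : Type*} {Ω : Matrix α α ℂ} (h : IsSiegel Ω) {e : β → α}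
    (he : Function.Injective e) : IsSiegel (Ω.submatrix e e) := by
  refine ⟨by rw [Matrix.transpose_submatrix, h.1], ?_⟩
  exact h.2.submatrix he

theorem inv_transpose [DecidableEq ι] {Ω : Matrix ι ι ℂ} (h : IsSiegel Ω) : (Ω⁻¹)ᵀ = Ω⁻¹ := by
  rw [Matrix.transpose_nonsing_inv, h.1]

/-- Symplectic inversion of the second block of coordinates preserves the Siegel space. -/
theorem partial_inv [DecidableEq ι₂] {A : Matrix ι₁ ι₁ ℂ} {B : Matrix ι₁ ι₂ ℂ}
    {D : Matrix ι₂ ι₂ ℂ} (h : IsSiegel (Matrix.fromBlocks A B Bᵀ D)) :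
    IsSiegel (Matrix.fromBlocks (A - B * D⁻¹ * Bᵀ) (B * D⁻¹) (D⁻¹ * Bᵀ) (-D⁻¹)) := by
  classical
  have hA : Aᵀ = A := by
    have := h.1; rw [Matrix.fromBlocks_transpose, Matrix.fromBlocks_inj] at this; exact this.1
  have hD : IsSiegel D := h.submatrix (e := Sum.inr) Sum.inr_injective
  have hDi := hD.inv_transpose
  refine of_im_pos ?_ fun x hx => ?_
  · rw [Matrix.fromBlocks_transpose]
    simp [Matrix.transpose_mul, hDi, hA, Matrix.mul_assoc]
  obtain ⟨x₁, y₂, rfl⟩ : ∃ (x₁ : ι₁ → ℝ) (y₂ : ι₂ → ℝ), x = Sum.elim x₁ y₂ :=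
    ⟨x ∘ Sum.inl, x ∘ Sum.inr, by simp⟩
  rw [Function.comp_def] at *
  set X : ι₁ → ℂ := fun a => (x₁ a : ℂ) with hX
  set Y : ι₂ → ℂ := fun a => (y₂ a : ℂ) with hY
  have hXY : (fun a => ((Sum.elim x₁ y₂ a : ℝ) : ℂ)) = Sum.elim X Y := by
    ext (a | a) <;> rfl
  rw [hXY]
  -- the complex vector with second image coordinate equal to the real vector `Y`
  set z₂ : ι₂ → ℂ := D⁻¹ *ᵥ (Y - Bᵀ *ᵥ X) with hz₂
  have hDz : D *ᵥ z₂ = Y - Bᵀ *ᵥ X := by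
    rw [hz₂, Matrix.mulVec_mulVec, Matrix.mul_nonsing_inv _ hD.isUnit_det, Matrix.one_mulVec]
  have hz : Sum.elim X z₂ ≠ 0 := by
    intro h0
    have h1 : X = 0 := by ext a; exact congrFun h0 (Sum.inl a)
    have h2 : z₂ = 0 := by ext a; exact congrFun h0 (Sum.inr a)
    have h3 : Y = 0 := by simpa [h1, h2] using hDz.symm
    apply hx
    ext (a | a)
    · simpa [hX] using congrFun h1 a
    · simpa [hY] using congrFun h3 a
  have hpos := h.im_star_form_pos hz
  have hstar : star (Sum.elim X z₂) = Sum.elim X (star z₂) := by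
    ext (a | a) <;> simp [hX]
  rw [hstar, Matrix.fromBlocks_mulVec, sumElim_dotProduct_sumElim] at hpos
  rw [Matrix.fromBlocks_mulVec, sumElim_dotProduct_sumElim]
  simp only [Sum.elim_comp_inl, Sum.elim_comp_inr, hDz] at hpos ⊢
  have e1 : (star z₂ ⬝ᵥ Y).im = -(z₂ ⬝ᵥ Y).im := by
    simp [dotProduct, hY, Complex.im_sum]
  have e2 : X ⬝ᵥ ((A - B * D⁻¹ * Bᵀ) *ᵥ X + (B * D⁻¹) *ᵥ Y) +
      Y ⬝ᵥ ((D⁻¹ * Bᵀ) *ᵥ X + (-D⁻¹) *ᵥ Y) = X ⬝ᵥ (A *ᵥ X + B *ᵥ z₂) - z₂ ⬝ᵥ Y := by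
    rw [dotProduct_comm z₂ Y, hz₂]
    simp only [Matrix.sub_mulVec, Matrix.mulVec_sub, ← Matrix.mulVec_mulVec, Matrix.neg_mulVec,
      dotProduct_add, dotProduct_sub, dotProduct_neg]
    ring
  rw [e2, Complex.sub_im]
  simp only [add_sub_cancel] at hpos
  rw [Complex.add_im, e1] at hpos
  linarith

theorem neg_inv [DecidableEq ι] {Ω : Matrix ι ι ℂ} (h : IsSiegel Ω) : IsSiegel (-Ω⁻¹) := by
  have h' : IsSiegel (Matrix.fromBlocks (0 : Matrix Empty Empty ℂ) 0 0ᵀ Ω) := by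
    have := h.submatrix (Equiv.emptySum Empty ι).injective
    convert this using 1
    ext (a | a) (b | b)
    · exact a.elim
    · exact a.elim
    · exact b.elim
    · rfl
  exact h'.partial_inv.submatrix (e := Sum.inr) Sum.inr_injective

end IsSiegel

/-! ### Summability of Gaussians over the integral lattice -/

theorem Matrix.PosDef.exists_pos_mul_sum_sq_le {ι : Type*} [Fintype ι] {Y : Matrix ι ι ℝ}
    (hY : Y.PosDef) : ∃ ε > 0, ∀ x : ι → ℝ, ε * ∑ a, x a ^ 2 ≤ x ⬝ᵥ Y *ᵥ x := by
  classical
  set q : EuclideanSpace ℝ ι → ℝ := fun x => x.ofLp ⬝ᵥ Y *ᵥ x.ofLp with hq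
  have hcont : Continuous q := by
    simp only [hq, dotProduct, Matrix.mulVec]
    fun_prop
  have hpos : ∀ x : EuclideanSpace ℝ ι, x ≠ 0 → 0 < q x := fun x hx => by
    simpa using hY.dotProduct_mulVec_pos (x := x.ofLp) (by simpa using hx)
  obtain ⟨ε, hε, hle⟩ : ∃ ε > 0, ∀ x ∈ Metric.sphere (0 : EuclideanSpace ℝ ι) 1, ε ≤ q x := by
    rcases (Metric.sphere (0 : EuclideanSpace ℝ ι) 1).eq_empty_or_nonempty with he | hne
    · exact ⟨1, one_pos, by simp [he]⟩
    · obtain ⟨u, hu, hmin⟩ := (isCompact_sphere (0 : EuclideanSpace ℝ ι) 1).exists_isMinOn hne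
        hcont.continuousOn
      refine ⟨q u, hpos u ?_, fun x hx => hmin hx⟩
      rintro rfl
      simp at hu
  refine ⟨ε, hε, fun x => ?_⟩
  set v : EuclideanSpace ℝ ι := WithLp.toLp 2 x with hv
  have hsq : ∑ a, x a ^ 2 = ‖v‖ ^ 2 := by simp [EuclideanSpace.norm_sq_eq, hv]
  rw [hsq]
  by_cases h0 : v = 0
  · have : x = 0 := by simpa [hv] using h0
    simp [this, h0]
  · have hn : 0 < ‖v‖ := norm_pos_iff.mpr h0
    have h1 := hle (‖v‖⁻¹ • v) (by simp [norm_smul, hn.ne'])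
    have h2 : q (‖v‖⁻¹ • v) = ‖v‖⁻¹ ^ 2 * (x ⬝ᵥ Y *ᵥ x) := by
      simp [hq, hv, Matrix.mulVec_smul]; ring
    rw [h2, inv_pow, ← div_eq_inv_mul, le_div_iff₀ (by positivity)] at h1
    exact h1

theorem summable_exp_neg_mul_sq_add_abs {ε : ℝ} (hε : 0 < ε) (C : ℝ) :
    Summable fun n : ℤ => Real.exp (-Real.pi * (ε * (n : ℝ) ^ 2) + C * |(n : ℝ)|) := by
  have hs : ∀ t : ℝ, Summable fun n : ℤ =>
      Real.exp (-Real.pi * (ε * (n : ℝ) ^ 2) + 2 * Real.pi * t * n) := by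
    intro t
    have h := ((summable_jacobiTheta₂_term_iff (-(t : ℂ) * Complex.I)
      (ε * Complex.I)).mpr (by simpa using hε)).norm
    refine h.congr fun n => ?_
    rw [norm_jacobiTheta₂_term]
    congr 1
    simp
    ring
  have hC : C = 2 * Real.pi * (C / (2 * Real.pi)) := by field_simp
  refine Summable.of_nonneg_of_le (fun _ => (Real.exp_pos _).le) (fun n => ?_)
    ((hs (C / (2 * Real.pi))).add (hs (-(C / (2 * Real.pi)))))
  rw [mul_neg, ← hC]
  rcases abs_cases (n : ℝ) with ⟨h, _⟩ | ⟨h, _⟩ <;> rw [h]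
  · exact le_add_of_nonneg_right (Real.exp_pos _).le
  · refine le_add_of_nonneg_of_le (Real.exp_pos _).le (le_of_eq ?_)
    congr 1
    ring

theorem summable_prod_apply (ι : Type*) [Finite ι] {X : Type*} {f : X → ℝ} (h0 : ∀ n, 0 ≤ f n)
    (hf : Summable f) : ∀ [Fintype ι], Summable fun x : ι → X => ∏ a, f (x a) := by
  induction ι using Finite.induction_empty_option with
  | @of_equiv α β e ih =>
    intro _
    have := Fintype.ofEquiv β e.symm
    let E : (α → X) ≃ (β → X) := e.arrowCongr (Equiv.refl X)
    rw [← Equiv.summable_iff E]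
    refine ih.congr fun x => ?_
    exact Fintype.prod_equiv e _ _ fun a => by simp [E]
  | h_empty => exact Summable.of_finite
  | @h_option α _ ih =>
    intro inst
    obtain rfl : inst = instFintypeOption := Subsingleton.elim _ _
    have h := hf.mul_of_nonneg ih h0 (fun x => Finset.prod_nonneg fun a _ => h0 _)
    let E : X × (α → X) ≃ (Option α → X) :=
      (Equiv.piOptionEquivProd (β := fun _ : Option α => X)).symm
    rw [← Equiv.summable_iff E]
    refine h.congr fun x => ?_
    rw [Function.comp_apply, Fintype.prod_option]
    simp [E, Equiv.piOptionEquivProd]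

theorem Matrix.PosDef.summable_exp_neg_form_add {ι : Type*} [Fintype ι] {Y : Matrix ι ι ℝ}
    (hY : Y.PosDef) (C : ℝ) : Summable fun x : ι → ℤ =>
      Real.exp (-Real.pi * ((fun a => (x a : ℝ)) ⬝ᵥ Y *ᵥ (fun a => (x a : ℝ))) +
        C * ∑ a, |(x a : ℝ)|) := by
  obtain ⟨ε, hε, hle⟩ := hY.exists_pos_mul_sum_sq_le
  refine Summable.of_nonneg_of_le (fun _ => (Real.exp_pos _).le) (fun x => ?_)
    (summable_prod_apply ι (fun _ => (Real.exp_pos _).le) (summable_exp_neg_mul_sq_add_abs hε C))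
  rw [← Real.exp_sum, Real.exp_le_exp, Finset.sum_add_distrib, ← Finset.mul_sum, ← Finset.mul_sum,
    ← Finset.mul_sum]
  have := mul_le_mul_of_nonneg_left (hle fun a => (x a : ℝ)) Real.pi_pos.le
  linarith

/-! ### The Riemann theta series -/

/-- An integral vector regarded as a complex vector. -/
def intVec {ι : Type*} (x : ι → ℤ) : ι → ℂ := fun a => (x a : ℂ)

/-- The general term `exp (π i (xᵀ Ω x + 2 xᵀ w))` of the Riemann theta series. -/
noncomputable def gaussTerm {ι : Type*} [Fintype ι] (Ω : Matrix ι ι ℂ) (w : ι → ℂ)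
    (x : ι → ℤ) : ℂ :=
  Complex.exp (Real.pi * Complex.I * (intVec x ⬝ᵥ Ω *ᵥ intVec x + 2 * (intVec x ⬝ᵥ w)))

/-- The inversion formula for the theta series at `Ω`, with factor `κ`. The right-hand side is
the sum over the lattice of translates of the Gaussian attached to `-Ω⁻¹`. -/
def IsInversionFactor {ι : Type*} [Fintype ι] [DecidableEq ι] (Ω : Matrix ι ι ℂ) (κ : ℂ) : Prop :=
  ∀ w : ι → ℂ, κ * ∑' x, gaussTerm Ω w x =
    ∑' y : ι → ℤ, Complex.exp (-(Real.pi * Complex.I) *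
      ((w - intVec y) ⬝ᵥ Ω⁻¹ *ᵥ (w - intVec y)))

section

variable {ι ι₁ ι₂ : Type*} [Fintype ι] [Fintype ι₁] [Fintype ι₂]

theorem norm_gaussTerm_le {Ω : Matrix ι ι ℂ} (w : ι → ℂ) (x : ι → ℤ) :
    ‖gaussTerm Ω w x‖ ≤ Real.exp (-Real.pi *
      ((fun a => (x a : ℝ)) ⬝ᵥ (Ω.map Complex.im) *ᵥ (fun a => (x a : ℝ))) +
        (2 * Real.pi * ∑ a, ‖w a‖) * ∑ a, |(x a : ℝ)|) := by
  rw [gaussTerm, Complex.norm_exp, Real.exp_le_exp]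
  have h1 : (intVec x ⬝ᵥ Ω *ᵥ intVec x).im =
      (fun a => (x a : ℝ)) ⬝ᵥ (Ω.map Complex.im) *ᵥ (fun a => (x a : ℝ)) := by
    rw [← IsSiegel.im_ofReal_form]
    congr 2
  have h2 : -(intVec x ⬝ᵥ w).im ≤ (∑ a, ‖w a‖) * ∑ a, |(x a : ℝ)| := by
    refine (neg_le_abs _).trans ((Complex.abs_im_le_norm _).trans ?_)
    refine (norm_sum_le _ _).trans ?_
    rw [Finset.mul_sum]
    refine Finset.sum_le_sum fun a _ => ?_
    rw [norm_mul, mul_comm]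
    have : ‖intVec x a‖ = |(x a : ℝ)| := by simp [intVec]
    rw [this]
    exact mul_le_mul_of_nonneg_right
      (Finset.single_le_sum (f := fun a => ‖w a‖) (fun _ _ => norm_nonneg _) (Finset.mem_univ a))
      (abs_nonneg _)
  have h3 : (Real.pi * Complex.I * (intVec x ⬝ᵥ Ω *ᵥ intVec x + 2 * (intVec x ⬝ᵥ w))).re =
      -Real.pi * (intVec x ⬝ᵥ Ω *ᵥ intVec x).im + 2 * Real.pi * -(intVec x ⬝ᵥ w).im := by
    simp
    ring
  rw [h3, h1]
  have := mul_le_mul_of_nonneg_left h2 (by positivity : 0 ≤ 2 * Real.pi)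
  linarith

theorem IsSiegel.summable_norm_gaussTerm_mul_exp {Ω : Matrix ι ι ℂ} (h : IsSiegel Ω) (w : ι → ℂ)
    (C : ℝ) : Summable fun x : ι → ℤ =>
      ‖gaussTerm Ω w x‖ * Real.exp (C * ∑ a, |(x a : ℝ)|) := by
  refine Summable.of_nonneg_of_le (fun _ => by positivity) (fun x => ?_)
    (h.2.summable_exp_neg_form_add ((2 * Real.pi * ∑ a, ‖w a‖) + C))
  refine (mul_le_mul_of_nonneg_right (norm_gaussTerm_le w x) (Real.exp_pos _).le).trans ?_
  rw [← Real.exp_add, add_mul, add_assoc]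

theorem IsSiegel.summable_gaussTerm {Ω : Matrix ι ι ℂ} (h : IsSiegel Ω) (w : ι → ℂ) :
    Summable (gaussTerm Ω w) := by
  have := h.summable_norm_gaussTerm_mul_exp w 0
  simp only [zero_mul, Real.exp_zero, mul_one] at this
  exact this.of_norm

theorem dotProduct_mulVec_transpose {R : Type*} [CommSemiring R] (M : Matrix ι₁ ι₂ R) (x : ι₁ → R)
    (y : ι₂ → R) : x ⬝ᵥ M *ᵥ y = y ⬝ᵥ Mᵀ *ᵥ x := by
  rw [Matrix.dotProduct_mulVec, dotProduct_comm, Matrix.mulVec_transpose]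

/-- Completing the square: the translated Gaussian of `-Ω⁻¹` is a theta term for `-Ω⁻¹`. -/
theorem IsSiegel.exp_neg_inv_form [DecidableEq ι] {Ω : Matrix ι ι ℂ} (h : IsSiegel Ω) (w : ι → ℂ)
    (y : ι → ℤ) : Complex.exp (-(Real.pi * Complex.I) *
      ((w - intVec y) ⬝ᵥ Ω⁻¹ *ᵥ (w - intVec y))) =
    Complex.exp (-(Real.pi * Complex.I) * (w ⬝ᵥ Ω⁻¹ *ᵥ w)) *
      gaussTerm (-Ω⁻¹) (Ω⁻¹ *ᵥ w) y := by
  have hc : w ⬝ᵥ Ω⁻¹ *ᵥ intVec y = intVec y ⬝ᵥ Ω⁻¹ *ᵥ w := by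
    rw [dotProduct_mulVec_transpose, h.inv_transpose]
  rw [gaussTerm, ← Complex.exp_add]
  congr 1
  simp only [sub_dotProduct, dotProduct_sub, Matrix.mulVec_sub, Matrix.neg_mulVec, dotProduct_neg,
    hc]
  ring

/-- The quadratic form of the inverse of a symmetric block matrix, through its Schur complement. -/
theorem form_inv_fromBlocks [DecidableEq ι₁] [DecidableEq ι₂] {A : Matrix ι₁ ι₁ ℂ}
    {B : Matrix ι₁ ι₂ ℂ} {D : Matrix ι₂ ι₂ ℂ} (hD : IsUnit D.det) (hDt : (D⁻¹)ᵀ = D⁻¹)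
    (hE : IsUnit (A - B * D⁻¹ * Bᵀ).det) (hΩ : IsUnit (Matrix.fromBlocks A B Bᵀ D).det)
    (v₁ : ι₁ → ℂ) (v₂ : ι₂ → ℂ) :
    Sum.elim v₁ v₂ ⬝ᵥ (Matrix.fromBlocks A B Bᵀ D)⁻¹ *ᵥ Sum.elim v₁ v₂ =
      v₂ ⬝ᵥ D⁻¹ *ᵥ v₂ + (v₁ - B *ᵥ D⁻¹ *ᵥ v₂) ⬝ᵥ (A - B * D⁻¹ * Bᵀ)⁻¹ *ᵥ (v₁ - B *ᵥ D⁻¹ *ᵥ v₂) := by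
  set E := A - B * D⁻¹ * Bᵀ with hEdef
  set u₁ := E⁻¹ *ᵥ (v₁ - B *ᵥ D⁻¹ *ᵥ v₂) with hu₁
  set u₂ := D⁻¹ *ᵥ (v₂ - Bᵀ *ᵥ u₁) with hu₂
  have hEu : E *ᵥ u₁ = v₁ - B *ᵥ D⁻¹ *ᵥ v₂ := by
    rw [hu₁, Matrix.mulVec_mulVec, Matrix.mul_nonsing_inv _ hE, Matrix.one_mulVec]
  have hDu : D *ᵥ u₂ = v₂ - Bᵀ *ᵥ u₁ := by
    rw [hu₂, Matrix.mulVec_mulVec, Matrix.mul_nonsing_inv _ hD, Matrix.one_mulVec]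
  have hΩu : Matrix.fromBlocks A B Bᵀ D *ᵥ Sum.elim u₁ u₂ = Sum.elim v₁ v₂ := by
    rw [Matrix.fromBlocks_mulVec]
    simp only [Sum.elim_comp_inl, Sum.elim_comp_inr, hDu, add_sub_cancel]
    congr 1
    rw [hEdef, Matrix.sub_mulVec, ← Matrix.mulVec_mulVec, ← Matrix.mulVec_mulVec] at hEu
    rw [hu₂, Matrix.mulVec_sub, Matrix.mulVec_sub, add_sub, add_sub_right_comm, hEu, sub_add_cancel]
  have hinv : (Matrix.fromBlocks A B Bᵀ D)⁻¹ *ᵥ Sum.elim v₁ v₂ = Sum.elim u₁ u₂ := by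
    rw [← hΩu, Matrix.mulVec_mulVec, Matrix.nonsing_inv_mul _ hΩ, Matrix.one_mulVec]
  rw [hinv, sumElim_dotProduct_sumElim, hu₂, Matrix.mulVec_sub, dotProduct_sub, sub_dotProduct]
  have : v₂ ⬝ᵥ D⁻¹ *ᵥ Bᵀ *ᵥ u₁ = B *ᵥ D⁻¹ *ᵥ v₂ ⬝ᵥ u₁ := by
    rw [dotProduct_mulVec_transpose, hDt, dotProduct_comm (Matrix.mulVec B _),
      dotProduct_mulVec_transpose B, dotProduct_comm]
  rw [this]
  ring

end

/-! ### Inversion one block of coordinates at a time -/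

section

variable {ι ι₁ ι₂ : Type*} [Fintype ι] [Fintype ι₁] [Fintype ι₂]
  [DecidableEq ι] [DecidableEq ι₁] [DecidableEq ι₂]

theorem intVec_sumElim {α β : Type*} (x : α → ℤ) (y : β → ℤ) :
    intVec (Sum.elim x y) = Sum.elim (intVec x) (intVec y) := by
  ext (a | a) <;> rfl

theorem tsum_sumElim {α β : Type*} {f : (α ⊕ β → ℤ) → ℂ} (hf : Summable f) :
    ∑' x, f x = ∑' (x₁ : α → ℤ) (x₂ : β → ℤ), f (Sum.elim x₁ x₂) := by
  rw [← (Equiv.sumArrowEquivProdArrow α β ℤ).symm.tsum_eq f]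
  exact Summable.tsum_prod ((Equiv.sumArrowEquivProdArrow α β ℤ).symm.summable_iff.mpr hf)

/-- Inversion can be carried out one block of coordinates after the other: first sum over the
second block, then, with the Schur complement as new matrix, over the first. -/
theorem IsInversionFactor.fromBlocks {A : Matrix ι₁ ι₁ ℂ} {B : Matrix ι₁ ι₂ ℂ} {D : Matrix ι₂ ι₂ ℂ}
    (h : IsSiegel (Matrix.fromBlocks A B Bᵀ D)) {κ₁ κ₂ : ℂ}
    (h₁ : IsInversionFactor (A - B * D⁻¹ * Bᵀ) κ₁) (h₂ : IsInversionFactor D κ₂) :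
    IsInversionFactor (Matrix.fromBlocks A B Bᵀ D) (κ₁ * κ₂) := by
  intro w
  obtain ⟨w₁, w₂, rfl⟩ : ∃ (w₁ : ι₁ → ℂ) (w₂ : ι₂ → ℂ), w = Sum.elim w₁ w₂ :=
    ⟨w ∘ Sum.inl, w ∘ Sum.inr, by simp⟩
  have hD : IsSiegel D := h.submatrix (e := Sum.inr) Sum.inr_injective
  have hP := h.partial_inv
  have hE : IsSiegel (A - B * D⁻¹ * Bᵀ) := hP.submatrix (e := Sum.inl) Sum.inl_injective
  have hDt := hD.inv_transpose
  set Q₂ : (ι₂ → ℤ) → ℂ := fun y₂ => Complex.exp (-(Real.pi * Complex.I) *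
    ((w₂ - intVec y₂) ⬝ᵥ D⁻¹ *ᵥ (w₂ - intVec y₂))) with hQ₂
  -- the mixed summand, after inversion of the second block only
  set F : (ι₁ → ℤ) → (ι₂ → ℤ) → ℂ := fun x₁ y₂ =>
    Q₂ y₂ * gaussTerm (A - B * D⁻¹ * Bᵀ) (w₁ - B *ᵥ D⁻¹ *ᵥ (w₂ - intVec y₂)) x₁ with hF
  have hcross : ∀ (u : ι₁ → ℂ) (v : ι₂ → ℂ), v ⬝ᵥ D⁻¹ *ᵥ Bᵀ *ᵥ u = u ⬝ᵥ B *ᵥ D⁻¹ *ᵥ v := by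
    intro u v
    rw [dotProduct_mulVec_transpose D⁻¹, hDt, dotProduct_comm, dotProduct_mulVec_transpose B,
      dotProduct_comm]
  have hsymm : ∀ u v : ι₂ → ℂ, u ⬝ᵥ D⁻¹ *ᵥ v = v ⬝ᵥ D⁻¹ *ᵥ u := by
    intro u v
    rw [dotProduct_mulVec_transpose D⁻¹, hDt]
  have hFsum : Summable (Function.uncurry F) := by
    have h0 := ((Equiv.sumArrowEquivProdArrow ι₁ ι₂ ℤ).symm.summable_iff.mpr
      (hP.summable_gaussTerm (Sum.elim (w₁ - B *ᵥ D⁻¹ *ᵥ w₂) (D⁻¹ *ᵥ w₂)))).mul_left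
      (Complex.exp (-(Real.pi * Complex.I) * (w₂ ⬝ᵥ D⁻¹ *ᵥ w₂)))
    refine h0.congr fun p => ?_
    obtain ⟨x₁, y₂⟩ := p
    change Complex.exp _ * gaussTerm _ _ (Sum.elim x₁ y₂) = Q₂ y₂ * gaussTerm _ _ x₁
    rw [hQ₂, gaussTerm, gaussTerm, ← Complex.exp_add, ← Complex.exp_add, intVec_sumElim,
      Matrix.fromBlocks_mulVec, sumElim_dotProduct_sumElim, sumElim_dotProduct_sumElim]
    congr 1
    simp only [Sum.elim_comp_inl, Sum.elim_comp_inr, dotProduct_add, dotProduct_sub,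
      sub_dotProduct, Matrix.mulVec_sub, Matrix.sub_mulVec, Matrix.neg_mulVec, dotProduct_neg,
      ← Matrix.mulVec_mulVec, hcross, hsymm w₂ (intVec y₂)]
    ring
  have hrow : ∀ x₁ : ι₁ → ℤ, κ₂ * ∑' x₂ : ι₂ → ℤ,
      gaussTerm (Matrix.fromBlocks A B Bᵀ D) (Sum.elim w₁ w₂) (Sum.elim x₁ x₂) =
      ∑' y₂, F x₁ y₂ := by
    intro x₁
    have e1 : ∀ x₂ : ι₂ → ℤ,
        gaussTerm (Matrix.fromBlocks A B Bᵀ D) (Sum.elim w₁ w₂) (Sum.elim x₁ x₂) =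
        gaussTerm A w₁ x₁ * gaussTerm D (w₂ + Bᵀ *ᵥ intVec x₁) x₂ := by
      intro x₂
      rw [gaussTerm, gaussTerm, gaussTerm, ← Complex.exp_add, intVec_sumElim,
        Matrix.fromBlocks_mulVec, sumElim_dotProduct_sumElim, sumElim_dotProduct_sumElim]
      congr 1
      have : intVec x₁ ⬝ᵥ B *ᵥ intVec x₂ = intVec x₂ ⬝ᵥ Bᵀ *ᵥ intVec x₁ :=
        dotProduct_mulVec_transpose _ _ _
      simp only [Sum.elim_comp_inl, Sum.elim_comp_inr, dotProduct_add, this]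
      ring
    simp_rw [e1]
    rw [tsum_mul_left, mul_left_comm, h₂, ← tsum_mul_left]
    refine tsum_congr fun y₂ => ?_
    rw [hF, hQ₂]
    simp only [gaussTerm]
    rw [← Complex.exp_add, ← Complex.exp_add]
    congr 1
    simp only [dotProduct_add, dotProduct_sub, add_dotProduct,
      sub_dotProduct, Matrix.mulVec_sub, Matrix.mulVec_add, Matrix.sub_mulVec,
      ← Matrix.mulVec_mulVec, hcross, hsymm w₂ (intVec y₂),
      dotProduct_comm (Bᵀ *ᵥ intVec x₁) (D⁻¹ *ᵥ _)]
    have hc2 : ∀ v : ι₂ → ℂ, Bᵀ *ᵥ intVec x₁ ⬝ᵥ D⁻¹ *ᵥ v = intVec x₁ ⬝ᵥ B *ᵥ D⁻¹ *ᵥ v := by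
      intro v
      rw [dotProduct_comm, dotProduct_mulVec_transpose Bᵀ, Matrix.transpose_transpose]
    simp only [hc2, dotProduct_comm (D⁻¹ *ᵥ _) (Bᵀ *ᵥ intVec x₁)]
    ring
  have hΩs := h.summable_gaussTerm (Sum.elim w₁ w₂)
  have hdual : Summable fun y : ι₁ ⊕ ι₂ → ℤ => Complex.exp (-(Real.pi * Complex.I) *
      ((Sum.elim w₁ w₂ - intVec y) ⬝ᵥ (Matrix.fromBlocks A B Bᵀ D)⁻¹ *ᵥ
        (Sum.elim w₁ w₂ - intVec y))) := by
    simp_rw [h.exp_neg_inv_form]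
    exact (h.neg_inv.summable_gaussTerm _).mul_left _
  have hdual' := (Equiv.sumArrowEquivProdArrow ι₁ ι₂ ℤ).symm.summable_iff.mpr hdual
  calc κ₁ * κ₂ * ∑' x, gaussTerm (Matrix.fromBlocks A B Bᵀ D) (Sum.elim w₁ w₂) x
      = κ₁ * ∑' x₁, ∑' y₂, F x₁ y₂ := by
        rw [tsum_sumElim hΩs, mul_assoc, ← tsum_mul_left]
        simp_rw [hrow]
    _ = ∑' y₂, ∑' y₁ : ι₁ → ℤ, Complex.exp (-(Real.pi * Complex.I) *
          ((Sum.elim w₁ w₂ - intVec (Sum.elim y₁ y₂)) ⬝ᵥ (Matrix.fromBlocks A B Bᵀ D)⁻¹ *ᵥ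
            (Sum.elim w₁ w₂ - intVec (Sum.elim y₁ y₂)))) := by
        rw [← hFsum.tsum_comm, ← tsum_mul_left]
        refine tsum_congr fun y₂ => ?_
        rw [hF, tsum_mul_left, mul_left_comm, h₁, ← tsum_mul_left]
        refine tsum_congr fun y₁ => ?_
        have e2 : Sum.elim w₁ w₂ - intVec (Sum.elim y₁ y₂) =
            Sum.elim (w₁ - intVec y₁) (w₂ - intVec y₂) := by
          rw [intVec_sumElim]; ext (a | a) <;> rfl
        rw [e2, form_inv_fromBlocks hD.isUnit_det hDt hE.isUnit_det h.isUnit_det, hQ₂,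
          ← Complex.exp_add, sub_right_comm w₁]
        congr 1
        ring
    _ = _ := by
        rw [tsum_sumElim hdual]
        exact Summable.tsum_comm hdual'

theorem IsInversionFactor.reindex {Ω : Matrix ι₂ ι₂ ℂ} (e : ι₁ ≃ ι₂) {κ : ℂ}
    (h : IsInversionFactor (Ω.submatrix e e) κ) : IsInversionFactor Ω κ := by
  intro w
  have h' := h (w ∘ e)
  let E : (ι₁ → ℤ) ≃ (ι₂ → ℤ) := e.arrowCongr (Equiv.refl ℤ)
  have hE : ∀ x, intVec (E x) ∘ e = intVec x := fun x => by ext a; simp [intVec, E]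
  rw [← E.tsum_eq, ← E.tsum_eq (fun y : ι₂ → ℤ => _)]
  have hdot : ∀ (u v : ι₂ → ℂ), u ⬝ᵥ v = (u ∘ e) ⬝ᵥ (v ∘ e) := fun u v =>
    (Fintype.sum_equiv e _ _ fun a => rfl).symm
  have hmul : ∀ (M : Matrix ι₂ ι₂ ℂ) (v : ι₂ → ℂ), (M *ᵥ v) ∘ e = M.submatrix e e *ᵥ (v ∘ e) := by
    intro M v
    ext a
    exact (Fintype.sum_equiv e _ _ fun a => rfl).symm
  have e₁ : ∀ x, gaussTerm Ω w (E x) = gaussTerm (Ω.submatrix e e) (w ∘ e) x := fun x => by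
    rw [gaussTerm, gaussTerm, hdot, hdot _ w, hmul, hE]
  have e₂ : ∀ y, (w - intVec (E y)) ⬝ᵥ Ω⁻¹ *ᵥ (w - intVec (E y)) =
      (w ∘ e - intVec y) ⬝ᵥ (Ω.submatrix e e)⁻¹ *ᵥ (w ∘ e - intVec y) := fun y => by
    have : (w - intVec (E y)) ∘ e = w ∘ e - intVec y := by rw [← hE]; rfl
    rw [hdot, hmul, Matrix.inv_submatrix_equiv, this]
  simp_rw [e₁, e₂]
  exact h'

/-- In one variable, the inversion formula is the functional equation of `jacobiTheta₂`. -/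
theorem isInversionFactor_of_unique [Unique ι] {Ω : Matrix ι ι ℂ} (h : IsSiegel Ω) :
    IsInversionFactor Ω ((-Complex.I * Ω default default) ^ (1 / 2 : ℂ)) := by
  intro w
  set τ := Ω default default with hτ
  have him : 0 < τ.im := h.2.diag_pos
  have h0 : τ ≠ 0 := by rintro h0; simp [h0] at him
  let E : ℤ ≃ (ι → ℤ) := (Equiv.funUnique ι ℤ).symm
  have e1 : ∑' x, gaussTerm Ω w x = jacobiTheta₂ (w default) τ := by
    rw [← E.tsum_eq, jacobiTheta₂]
    refine tsum_congr fun n => ?_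
    rw [gaussTerm, jacobiTheta₂_term]
    congr 1
    simp [intVec, E, dotProduct, Matrix.mulVec, ← hτ]
    ring
  have hinv : Ω⁻¹ default default = τ⁻¹ := by
    rw [Matrix.inv_def, Matrix.det_unique]
    simp [Matrix.adjugate_subsingleton, hτ]
  rw [e1, jacobiTheta₂_functional_equation, ← E.tsum_eq (fun y : ι → ℤ => _), jacobiTheta₂,
    ← tsum_mul_left, ← tsum_mul_left]
  refine tsum_congr fun n => ?_
  have hne : (-Complex.I * τ) ^ (1 / 2 : ℂ) ≠ 0 := by
    rw [Complex.cpow_ne_zero_iff]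
    left
    simp [h0]
  rw [← mul_assoc, ← mul_assoc, mul_one_div_cancel hne, one_mul, jacobiTheta₂_term,
    ← Complex.exp_add]
  congr 1
  simp only [intVec, E, dotProduct, Matrix.mulVec, Fintype.sum_unique, hinv, Pi.sub_apply]
  simp
  field_simp
  ring

end

/-! ### Continuity of the inversion factor -/

theorem ContinuousOn.matrix_inv {X n : Type*} [TopologicalSpace X] [Fintype n] [DecidableEq n]
    {s : Set X} {f : X → Matrix n n ℂ} (hf : ContinuousOn f s) (h0 : ∀ x ∈ s, IsUnit (f x).det) :
    ContinuousOn (fun x => (f x)⁻¹) s := by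
  have hdet : ContinuousOn (fun x => (f x).det) s :=
    (continuous_id.matrix_det).comp_continuousOn hf
  have hadj : ContinuousOn (fun x => (f x).adjugate) s :=
    (continuous_id.matrix_adjugate).comp_continuousOn hf
  simp only [Matrix.inv_def, Ring.inverse_eq_inv']
  exact (hdet.inv₀ fun x hx => (h0 x hx).ne_zero).smul hadj

/-- The assertion that an inversion factor can be chosen continuously on the Siegel space, as a
square root of `det (-i Ω)`. -/
def HasContinuousInversionFactor (ι : Type*) [Fintype ι] [DecidableEq ι] : Prop :=
  ∃ κ : Matrix ι ι ℂ → ℂ, ContinuousOn κ {Ω | IsSiegel Ω} ∧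
    ∀ Ω, IsSiegel Ω → κ Ω ^ 2 = (-Complex.I) ^ Fintype.card ι * Ω.det ∧ IsInversionFactor Ω (κ Ω)

section

variable {ι ι₁ ι₂ : Type*} [Fintype ι] [Fintype ι₁] [Fintype ι₂]
  [DecidableEq ι] [DecidableEq ι₁] [DecidableEq ι₂]

theorem HasContinuousInversionFactor.reindex (e : ι₁ ≃ ι₂) (h : HasContinuousInversionFactor ι₁) :
    HasContinuousInversionFactor ι₂ := by
  obtain ⟨κ, hc, hκ⟩ := h
  have hmaps : ∀ Ω : Matrix ι₂ ι₂ ℂ, IsSiegel Ω → IsSiegel (Ω.submatrix e e) :=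
    fun Ω hΩ => hΩ.submatrix e.injective
  refine ⟨fun Ω => κ (Ω.submatrix e e), hc.comp ?_ hmaps, fun Ω hΩ => ?_⟩
  · exact (continuous_id.matrix_submatrix e e).continuousOn
  · obtain ⟨h1, h2⟩ := hκ _ (hmaps Ω hΩ)
    refine ⟨?_, h2.reindex e⟩
    rw [h1, Matrix.det_submatrix_equiv_self, Fintype.card_congr e]

theorem HasContinuousInversionFactor.of_isEmpty [IsEmpty ι] : HasContinuousInversionFactor ι := by
  refine ⟨fun _ => 1, continuousOn_const, fun Ω _ => ⟨by simp, fun w => ?_⟩⟩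
  have : Unique (ι → ℤ) := Pi.uniqueOfIsEmpty _
  simp [gaussTerm]

theorem HasContinuousInversionFactor.of_unique [Unique ι] : HasContinuousInversionFactor ι := by
  refine ⟨fun Ω => (-Complex.I * Ω default default) ^ (1 / 2 : ℂ), ?_, fun Ω hΩ => ⟨?_, ?_⟩⟩
  · refine ContinuousOn.cpow_const ?_ fun Ω hΩ => ?_
    · fun_prop
    · left
      have := hΩ.2.diag_pos (i := default)
      simpa using this
  · rw [← Complex.cpow_nat_mul]
    simp [Matrix.det_unique]
  · exact isInversionFactor_of_unique hΩ

theorem HasContinuousInversionFactor.sum (h₁ : HasContinuousInversionFactor ι₁)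
    (h₂ : HasContinuousInversionFactor ι₂) : HasContinuousInversionFactor (ι₁ ⊕ ι₂) := by
  obtain ⟨κ₁, hc₁, hκ₁⟩ := h₁
  obtain ⟨κ₂, hc₂, hκ₂⟩ := h₂
  set schur : Matrix (ι₁ ⊕ ι₂) (ι₁ ⊕ ι₂) ℂ → Matrix ι₁ ι₁ ℂ := fun Ω =>
    Ω.toBlocks₁₁ - Ω.toBlocks₁₂ * Ω.toBlocks₂₂⁻¹ * Ω.toBlocks₁₂ᵀ with hschur
  have hblocks : ∀ Ω : Matrix (ι₁ ⊕ ι₂) (ι₁ ⊕ ι₂) ℂ, IsSiegel Ω →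
      Ω = Matrix.fromBlocks Ω.toBlocks₁₁ Ω.toBlocks₁₂ Ω.toBlocks₁₂ᵀ Ω.toBlocks₂₂ := by
    intro Ω hΩ
    conv_lhs => rw [← Matrix.fromBlocks_toBlocks Ω]
    congr 1
    ext a b
    exact congrFun (congrFun hΩ.1 (Sum.inl b)) (Sum.inr a)
  have hD : ∀ Ω : Matrix (ι₁ ⊕ ι₂) (ι₁ ⊕ ι₂) ℂ, IsSiegel Ω → IsSiegel Ω.toBlocks₂₂ := fun Ω hΩ =>
    hΩ.submatrix (e := Sum.inr) Sum.inr_injective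
  have hE : ∀ Ω, IsSiegel Ω → IsSiegel (schur Ω) := fun Ω hΩ => by
    have h := hΩ
    rw [hblocks Ω hΩ] at h
    exact h.partial_inv.submatrix (e := Sum.inl) Sum.inl_injective
  have c22 : Continuous fun Ω : Matrix (ι₁ ⊕ ι₂) (ι₁ ⊕ ι₂) ℂ => Ω.toBlocks₂₂ :=
    continuous_id.matrix_submatrix Sum.inr Sum.inr
  have c11 : Continuous fun Ω : Matrix (ι₁ ⊕ ι₂) (ι₁ ⊕ ι₂) ℂ => Ω.toBlocks₁₁ :=
    continuous_id.matrix_submatrix Sum.inl Sum.inl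
  have c12 : Continuous fun Ω : Matrix (ι₁ ⊕ ι₂) (ι₁ ⊕ ι₂) ℂ => Ω.toBlocks₁₂ :=
    continuous_id.matrix_submatrix Sum.inl Sum.inr
  have cschur : ContinuousOn schur {Ω | IsSiegel Ω} := by
    have cinv := c22.continuousOn.matrix_inv (s := {Ω | IsSiegel Ω})
      fun Ω hΩ => (hD Ω hΩ).isUnit_det
    have hmul : Continuous fun p : Matrix ι₁ ι₂ ℂ × Matrix ι₂ ι₂ ℂ => p.1 * p.2 * p.1ᵀ :=
      (continuous_fst.matrix_mul continuous_snd).matrix_mul continuous_fst.matrix_transpose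
    have c2 := hmul.comp_continuousOn (c12.continuousOn.prodMk cinv)
    exact c11.continuousOn.sub c2
  refine ⟨fun Ω => κ₁ (schur Ω) * κ₂ Ω.toBlocks₂₂, ?_, fun Ω hΩ => ⟨?_, ?_⟩⟩
  · have g₁ : ContinuousOn (fun Ω => κ₁ (schur Ω)) {Ω | IsSiegel Ω} :=
      ContinuousOn.comp (t := {Ω | IsSiegel Ω}) hc₁ cschur hE
    have g₂ : ContinuousOn (fun Ω : Matrix (ι₁ ⊕ ι₂) (ι₁ ⊕ ι₂) ℂ => κ₂ Ω.toBlocks₂₂)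
        {Ω | IsSiegel Ω} :=
      ContinuousOn.comp (t := {Ω | IsSiegel Ω}) hc₂ c22.continuousOn hD
    exact g₁.mul g₂
  · rw [mul_pow, (hκ₁ _ (hE Ω hΩ)).1, (hκ₂ _ (hD Ω hΩ)).1]
    conv_rhs => rw [hblocks Ω hΩ]
    have := Matrix.invertibleOfIsUnitDet _ (hD Ω hΩ).isUnit_det
    rw [Matrix.det_fromBlocks₂₂, Fintype.card_sum, pow_add, Matrix.invOf_eq_nonsing_inv]
    ring
  · have h := hΩ
    rw [hblocks Ω hΩ] at h
    have := IsInversionFactor.fromBlocks h (hκ₁ _ (hE Ω hΩ)).2 (hκ₂ _ (hD Ω hΩ)).2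
    rwa [← hblocks Ω hΩ] at this

end

theorem hasContinuousInversionFactor (ι : Type*) [Finite ι] :
    ∀ [Fintype ι] [DecidableEq ι], HasContinuousInversionFactor ι := by
  induction ι using Finite.induction_empty_option with
  | @of_equiv α β e ih =>
    intro _ _
    classical
    have := Fintype.ofEquiv β e.symm
    exact ih.reindex e
  | h_empty => exact HasContinuousInversionFactor.of_isEmpty
  | @h_option α _ ih =>
    intro _ _
    classical
    exact (ih.sum HasContinuousInversionFactor.of_unique).reindex
      (Equiv.optionEquivSumPUnit.{0} α).symm

/-! ### Theta series of an integral quadratic form in matrix variables -/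

/-- The exponential factor `exp (π i tr (S L Z Lᵀ))` of the theta series of `S`. -/
noncomputable def thetaExp {ρ ν : Type*} [Fintype ρ] [Fintype ν] (S : Matrix ρ ρ ℤ)
    (Z : Matrix ν ν ℂ) (L : Matrix ρ ν ℤ) : ℂ :=
  Complex.exp (Real.pi * Complex.I * (intToComplex (S * L) * Z * intToComplex Lᵀ).trace)

section intToComplex

variable {l m n : Type*} [Fintype m]

theorem intToComplex_mul (A : Matrix l m ℤ) (B : Matrix m n ℤ) :
    intToComplex (A * B) = intToComplex A * intToComplex B :=
  Matrix.map_mul (f := Int.castRingHom ℂ)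

theorem intToComplex_one {m : Type*} [DecidableEq m] : intToComplex (1 : Matrix m m ℤ) = 1 := by
  ext i j; by_cases h : i = j <;> simp [intToComplex, h, Matrix.one_apply]

theorem det_intToComplex [DecidableEq m] (A : Matrix m m ℤ) :
    (intToComplex A).det = (A.det : ℂ) :=
  ((Int.castRingHom ℂ).map_det A).symm

theorem trace_intToComplex (A : Matrix m m ℤ) : (intToComplex A).trace = (A.trace : ℂ) := by
  simp [Matrix.trace, intToComplex]

theorem intToComplex_add {l m : Type*} (A B : Matrix l m ℤ) :
    intToComplex (A + B) = intToComplex A + intToComplex B := by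
  ext; simp [intToComplex]

theorem intToComplex_neg {l m : Type*} (A : Matrix l m ℤ) :
    intToComplex (-A) = -intToComplex A := by
  ext; simp [intToComplex]

theorem intToComplex_zero {l m : Type*} : intToComplex (0 : Matrix l m ℤ) = 0 := by
  ext; simp [intToComplex]

theorem intToComplex_transpose {l m : Type*} (A : Matrix l m ℤ) :
    intToComplex Aᵀ = (intToComplex A)ᵀ := rfl

end intToComplex

section

variable {ρ ν : Type*} [Fintype ρ] [Fintype ν]

theorem gaussTerm_kronecker {S : Matrix ρ ρ ℤ} (hS : Sᵀ = S) (Z : Matrix ν ν ℂ)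
    (w : Matrix ρ ν ℂ) (L : Matrix ρ ν ℤ) :
    gaussTerm (intToComplex S ⊗ₖ Z) (Matrix.vec wᵀ) (Matrix.vec Lᵀ) =
      thetaExp S Z L * Complex.exp (2 * Real.pi * Complex.I * (wᵀ * intToComplex L).trace) := by
  have hvec : intVec (Matrix.vec Lᵀ) = Matrix.vec (intToComplex L)ᵀ := rfl
  rw [gaussTerm, thetaExp, hvec, ← Complex.exp_add, Matrix.kronecker_mulVec_vec,
    Matrix.vec_dotProduct_vec, Matrix.vec_dotProduct_vec, ← intToComplex_transpose S, hS,
    intToComplex_mul, Matrix.transpose_transpose, intToComplex_transpose]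
  have e1 : (intToComplex L * (Z * (intToComplex L)ᵀ * intToComplex S)).trace =
      (intToComplex S * intToComplex L * Z * (intToComplex L)ᵀ).trace := by
    rw [← Matrix.mul_assoc, Matrix.trace_mul_comm]
    simp only [Matrix.mul_assoc]
  have e2 : (intToComplex L * wᵀ).trace = (wᵀ * intToComplex L).trace := Matrix.trace_mul_comm _ _
  rw [e1, e2]
  congr 1
  ring

theorem isSiegel_kronecker {S : Matrix ρ ρ ℤ} (hS : (S.map (fun a : ℤ => (a : ℝ))).PosDef)
    {Z : Matrix ν ν ℂ} (hZ : IsSiegel Z) : IsSiegel (intToComplex S ⊗ₖ Z) := by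
  classical
  constructor
  · have hSt : Sᵀ = S := by
      ext i j
      have := congrFun (congrFun hS.isHermitian i) j
      simpa using this
    rw [← Matrix.kroneckerMap_transpose, hZ.1, ← intToComplex_transpose, hSt]
  · have h := hS.kronecker hZ.2
    have e : (intToComplex S ⊗ₖ Z).map Complex.im =
        S.map (fun a : ℤ => (a : ℝ)) ⊗ₖ Z.map Complex.im := by
      funext ⟨a, i⟩ ⟨b, j⟩
      simp [intToComplex]
    rw [e]
    exact h

/-- The bijection between integral matrices and integral vectors indexed by their entries. -/
def vecTransposeEquiv (ρ ν : Type*) : Matrix ρ ν ℤ ≃ (ρ × ν → ℤ) :=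
  (Equiv.curry ρ ν ℤ).symm

theorem vecTransposeEquiv_apply {ρ ν : Type*} (L : Matrix ρ ν ℤ) :
    vecTransposeEquiv ρ ν L = Matrix.vec Lᵀ := rfl

theorem summable_thetaExp_mul_exp {S : Matrix ρ ρ ℤ}
    (hS : (S.map (fun a : ℤ => (a : ℝ))).PosDef) (hSt : Sᵀ = S)
    {Z : Matrix ν ν ℂ} (hZ : IsSiegel Z) (C : ℝ) :
    Summable fun L : Matrix ρ ν ℤ =>
      ‖thetaExp S Z L‖ * Real.exp (C * ∑ a, ∑ i, |(L a i : ℝ)|) := by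
  have h := (isSiegel_kronecker hS hZ).summable_norm_gaussTerm_mul_exp
    (Matrix.vec (0 : Matrix ρ ν ℂ)ᵀ) C
  refine ((vecTransposeEquiv ρ ν).summable_iff.mpr h).congr fun L => ?_
  simp only [Function.comp_apply, vecTransposeEquiv_apply]
  rw [gaussTerm_kronecker hSt, Fintype.sum_prod_type]
  simp

/-- Left multiplication by a unimodular matrix, as a bijection of integral matrices. -/
noncomputable def mulLeftEquiv [DecidableEq ρ] (ν : Type*) (S : Matrix ρ ρ ℤ) (hS : IsUnit S.det) :
    Matrix ρ ν ℤ ≃ Matrix ρ ν ℤ where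
  toFun L := S * L
  invFun L := S⁻¹ * L
  left_inv L := by simp [← Matrix.mul_assoc, Matrix.nonsing_inv_mul _ hS]
  right_inv L := by simp [← Matrix.mul_assoc, Matrix.mul_nonsing_inv _ hS]

/-- Right multiplication by a unimodular matrix, as a bijection of integral matrices. -/
noncomputable def mulRightEquiv [DecidableEq ν] (ρ : Type*) (U : Matrix ν ν ℤ) (hU : IsUnit U.det) :
    Matrix ρ ν ℤ ≃ Matrix ρ ν ℤ where
  toFun L := L * U
  invFun L := L * U⁻¹
  left_inv L := by simp [Matrix.mul_assoc, Matrix.mul_nonsing_inv _ hU]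
  right_inv L := by simp [Matrix.mul_assoc, Matrix.nonsing_inv_mul _ hU]

/-- The inversion formula in matrix form: the unimodularity of `S` turns the sum over the dual
lattice into a sum over the lattice itself. -/
theorem theta_inversion_of_factor [DecidableEq ρ] [DecidableEq ν] {S : Matrix ρ ρ ℤ}
    (hS : (S.map (fun a : ℤ => (a : ℝ))).PosDef) (hSt : Sᵀ = S) (hSu : IsUnit S.det)
    {Z : Matrix ν ν ℂ} (hZ : IsSiegel Z) {κ : ℂ}
    (hκ : IsInversionFactor (intToComplex S ⊗ₖ Z) κ) (w : Matrix ρ ν ℂ) :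
    ∑' N : Matrix ρ ν ℤ, thetaExp S (-Z⁻¹) N *
        Complex.exp (2 * Real.pi * Complex.I * (wᵀ * (intToComplex N * Z⁻¹)).trace) =
      κ * Complex.exp (Real.pi * Complex.I * ((intToComplex S)⁻¹ * w * Z⁻¹ * wᵀ).trace) *
        ∑' L : Matrix ρ ν ℤ, thetaExp S Z L *
          Complex.exp (2 * Real.pi * Complex.I * (wᵀ * intToComplex L).trace) := by
  have hΩ := isSiegel_kronecker hS hZ
  have hSc : IsUnit (intToComplex S).det := by
    rw [det_intToComplex]; exact hSu.map (Int.castRingHom ℂ)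
  have hSit : ((intToComplex S)⁻¹)ᵀ = (intToComplex S)⁻¹ := by
    rw [Matrix.transpose_nonsing_inv, ← intToComplex_transpose, hSt]
  have h := hκ (Matrix.vec wᵀ)
  simp_rw [hΩ.exp_neg_inv_form] at h
  rw [tsum_mul_left, ← (vecTransposeEquiv ρ ν).tsum_eq,
    ← ((mulLeftEquiv ν S hSu).trans (vecTransposeEquiv ρ ν)).tsum_eq (gaussTerm (-_) _)] at h
  simp only [Equiv.trans_apply, vecTransposeEquiv_apply, gaussTerm_kronecker hSt] at h
  have e1 : Matrix.vec wᵀ ⬝ᵥ (intToComplex S ⊗ₖ Z)⁻¹ *ᵥ Matrix.vec wᵀ =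
      ((intToComplex S)⁻¹ * w * Z⁻¹ * wᵀ).trace := by
    rw [Matrix.inv_kronecker, Matrix.kronecker_mulVec_vec, Matrix.vec_dotProduct_vec, hSit,
      Matrix.transpose_transpose, ← Matrix.mul_assoc, Matrix.trace_mul_comm]
    simp only [Matrix.mul_assoc]
  have e2 : ∀ N : Matrix ρ ν ℤ, gaussTerm (-(intToComplex S ⊗ₖ Z)⁻¹)
      ((intToComplex S ⊗ₖ Z)⁻¹ *ᵥ Matrix.vec wᵀ) (Matrix.vec (mulLeftEquiv ν S hSu N)ᵀ) =
      thetaExp S (-Z⁻¹) N *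
        Complex.exp (2 * Real.pi * Complex.I * (wᵀ * (intToComplex N * Z⁻¹)).trace) := by
    intro N
    have hvec : intVec (Matrix.vec (mulLeftEquiv ν S hSu N)ᵀ) =
        Matrix.vec (intToComplex (S * N))ᵀ := rfl
    rw [gaussTerm, thetaExp, hvec, ← Complex.exp_add, Matrix.inv_kronecker, Matrix.neg_mulVec,
      Matrix.kronecker_mulVec_vec, Matrix.kronecker_mulVec_vec, dotProduct_neg,
      Matrix.vec_dotProduct_vec, Matrix.vec_dotProduct_vec, hSit, intToComplex_mul,
      Matrix.transpose_transpose, Matrix.transpose_mul, ← intToComplex_transpose S, hSt,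
      intToComplex_transpose]
    have f1 : (intToComplex S * intToComplex N *
        (Z⁻¹ * ((intToComplex N)ᵀ * intToComplex S) * (intToComplex S)⁻¹)).trace =
        (intToComplex S * intToComplex N * Z⁻¹ * (intToComplex N)ᵀ).trace := by
      simp only [Matrix.mul_assoc, Matrix.mul_nonsing_inv _ hSc, Matrix.mul_one]
    have f2 : (intToComplex S * intToComplex N * (Z⁻¹ * wᵀ * (intToComplex S)⁻¹)).trace =
        (wᵀ * (intToComplex N * Z⁻¹)).trace := by
      rw [Matrix.mul_assoc, Matrix.trace_mul_comm, ← Matrix.mul_assoc]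
      rw [show intToComplex N * (Z⁻¹ * wᵀ) * (intToComplex S)⁻¹ * intToComplex S =
        intToComplex N * Z⁻¹ * wᵀ by
          simp only [Matrix.mul_assoc, Matrix.nonsing_inv_mul _ hSc, Matrix.mul_one],
        Matrix.trace_mul_comm]
    rw [f1, f2]
    congr 1
    simp only [Matrix.mul_neg, Matrix.neg_mul, Matrix.trace_neg]
    ring
  simp only [e1, e2] at h
  rw [mul_comm κ, mul_assoc (Complex.exp _), h, ← mul_assoc, ← Complex.exp_add]
  simp

end

/-! ### The inversion factor for an even unimodular form -/

theorem even_sum_sum_of_symm {ι : Type*} [Fintype ι] {f : ι → ι → ℤ} (hs : ∀ i j, f i j = f j i)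
    (hd : ∀ i, Even (f i i)) : Even (∑ i, ∑ j, f i j) := by
  classical
  rw [← ZMod.intCast_eq_zero_iff_even, ← Finset.sum_product', Int.cast_sum]
  refine Finset.sum_involution (fun p _ => p.swap) ?_ ?_ (by simp) (by simp)
  · intro p _
    rw [Prod.fst_swap, Prod.snd_swap, hs p.2 p.1]
    exact CharTwo.add_self_eq_zero _
  · rintro ⟨i, j⟩ _ hne h
    obtain rfl : j = i := congrArg Prod.fst h
    exact hne ((ZMod.intCast_eq_zero_iff_even).mpr (hd _))

section

variable {ρ ν : Type*} [Fintype ρ] [Fintype ν]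

theorem even_trace_mul_mul_transpose {S : Matrix ρ ρ ℤ} (hSt : Sᵀ = S) (hSe : ∀ i, Even (S i i))
    {B : Matrix ν ν ℤ} (hB : Bᵀ = B) (L : Matrix ρ ν ℤ) : Even (S * L * B * Lᵀ).trace := by
  have hdiag : ∀ i, Even ((Lᵀ * S * L) i i) := by
    intro i
    have : (Lᵀ * S * L) i i = ∑ a, ∑ b, L a i * S a b * L b i := by
      simp only [Matrix.mul_apply, Finset.sum_mul, Matrix.transpose_apply]
      exact Finset.sum_comm
    rw [this]
    refine even_sum_sum_of_symm (fun a b => ?_) fun a => ?_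
    · rw [show S a b = S b a from congrFun (congrFun hSt b) a]; ring
    · exact ((hSe a).mul_left _).mul_right _
  have hsymm : (Lᵀ * S * L)ᵀ = Lᵀ * S * L := by
    simp [Matrix.transpose_mul, hSt, Matrix.mul_assoc]
  have : (S * L * B * Lᵀ).trace = ∑ i, ∑ j, (Lᵀ * S * L) i j * B j i := by
    rw [Matrix.trace_mul_comm, ← Matrix.mul_assoc, ← Matrix.mul_assoc]
    rfl
  rw [this]
  refine even_sum_sum_of_symm (fun i j => ?_) fun i => (hdiag i).mul_right _
  rw [show (Lᵀ * S * L) i j = (Lᵀ * S * L) j i from congrFun (congrFun hsymm j) i,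
    show B i j = B j i from congrFun (congrFun hB j) i]

theorem thetaExp_add_intToComplex {S : Matrix ρ ρ ℤ} (hSt : Sᵀ = S) (hSe : ∀ i, Even (S i i))
    {B : Matrix ν ν ℤ} (hB : Bᵀ = B) (Z : Matrix ν ν ℂ) (L : Matrix ρ ν ℤ) :
    thetaExp S (Z + intToComplex B) L = thetaExp S Z L := by
  obtain ⟨r, hr⟩ := even_trace_mul_mul_transpose hSt hSe hB L
  rw [thetaExp, thetaExp, Matrix.mul_add, Matrix.add_mul, Matrix.trace_add, ← intToComplex_mul,
    ← intToComplex_mul, trace_intToComplex, hr, mul_add, Complex.exp_add]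
  have : Complex.exp (Real.pi * Complex.I * ((r + r : ℤ) : ℂ)) = 1 := by
    rw [← Complex.exp_int_mul_two_pi_mul_I r]
    congr 1
    push_cast
    ring
  rw [this, mul_one]

theorem summable_thetaExp {S : Matrix ρ ρ ℤ}
    (hS : (S.map (fun a : ℤ => (a : ℝ))).PosDef) (hSt : Sᵀ = S)
    {Z : Matrix ν ν ℂ} (hZ : IsSiegel Z) : Summable fun L : Matrix ρ ν ℤ => thetaExp S Z L := by
  have := summable_thetaExp_mul_exp hS hSt hZ 0
  simp only [zero_mul, Real.exp_zero, mul_one] at this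
  exact this.of_norm

end

theorem convex_setOf_isSiegel (ν : Type*) [Fintype ν] :
    Convex ℝ {Z : Matrix ν ν ℂ | IsSiegel Z} := by
  rw [convex_iff_forall_pos]
  intro X hX Y hY a b ha hb _
  refine ⟨by simp [hX.1, hY.1], ?_⟩
  have e : (a • X + b • Y).map Complex.im = a • X.map Complex.im + b • Y.map Complex.im := by
    ext i j; simp
  rw [e]
  exact (hX.2.smul ha).add (hY.2.smul hb)

theorem isSiegel_smul_one (ν : Type*) [Fintype ν] [DecidableEq ν] {z : ℂ} (hz : 0 < z.im) :
    IsSiegel (z • (1 : Matrix ν ν ℂ)) := by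
  refine ⟨by simp, ?_⟩
  have e : (z • (1 : Matrix ν ν ℂ)).map Complex.im = z.im • (1 : Matrix ν ν ℝ) := by
    ext i j
    by_cases h : i = j <;> simp [h]
  rw [e]
  exact Matrix.PosDef.one.smul hz

section

variable {ρ ν : Type*} [Fintype ρ] [Fintype ν] [DecidableEq ν]

theorem tsum_thetaExp_I_ne_zero {S : Matrix ρ ρ ℤ}
    (hS : (S.map (fun a : ℤ => (a : ℝ))).PosDef) (hSt : Sᵀ = S) :
    ∑' L : Matrix ρ ν ℤ, thetaExp S (Complex.I • 1) L ≠ 0 := by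
  have hsum := summable_thetaExp hS hSt (isSiegel_smul_one ν (z := Complex.I) (by simp))
  have hreal : ∀ L : Matrix ρ ν ℤ, thetaExp S (Complex.I • 1) L =
      ((Real.exp (-Real.pi * ((S * L * Lᵀ).trace : ℤ)) : ℝ) : ℂ) := by
    intro L
    rw [thetaExp, Matrix.mul_smul, Matrix.mul_one, Matrix.smul_mul, Matrix.trace_smul,
      ← intToComplex_mul, trace_intToComplex]
    push_cast
    congr 1
    rw [smul_eq_mul]
    linear_combination (Real.pi : ℂ) * (S * L * Lᵀ).trace * Complex.I_sq
  simp_rw [hreal] at hsum ⊢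
  rw [← Complex.ofReal_tsum, Complex.ofReal_ne_zero]
  exact ((Complex.summable_ofReal.mp hsum).tsum_pos (fun _ => (Real.exp_pos _).le) 0
    (Real.exp_pos _)).ne'

variable [DecidableEq ρ]

theorem det_eq_one_of_posDef {S : Matrix ρ ρ ℤ} (hS : (S.map (fun a : ℤ => (a : ℝ))).PosDef)
    (hSu : IsUnit S.det) : S.det = 1 := by
  have h := hS.det_pos
  have e : (S.map (fun a : ℤ => (a : ℝ))).det = (S.det : ℝ) :=
    ((Int.castRingHom ℝ).map_det S).symm
  rw [e] at h
  have h' : 0 < S.det := by exact_mod_cast h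
  rcases Int.isUnit_iff.mp hSu with h1 | h1 <;> omega

/-- The inversion factor of `S ⊗ Z`: it is a square root of `det (-i Z) ^ (2k)`, depends continuously
on `Z` in the connected Siegel space, and is `1` at `Z = i`. -/
theorem isInversionFactor_kronecker {S : Matrix ρ ρ ℤ}
    (hS : (S.map (fun a : ℤ => (a : ℝ))).PosDef) (hSt : Sᵀ = S) (hSu : IsUnit S.det)
    {k : ℕ} (hk : Fintype.card ρ = 2 * k) {Z : Matrix ν ν ℂ} (hZ : IsSiegel Z) :
    IsInversionFactor (intToComplex S ⊗ₖ Z) (((-Complex.I) ^ Fintype.card ν * Z.det) ^ k) := by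
  obtain ⟨κ, hc, hκ⟩ := hasContinuousInversionFactor (ρ × ν)
  set f : Matrix ν ν ℂ → ℂ := fun Z => κ (intToComplex S ⊗ₖ Z) with hf
  set g : Matrix ν ν ℂ → ℂ := fun Z => ((-Complex.I) ^ Fintype.card ν * Z.det) ^ k with hg
  have hmaps : ∀ Z : Matrix ν ν ℂ, IsSiegel Z → IsSiegel (intToComplex S ⊗ₖ Z) :=
    fun Z hZ => isSiegel_kronecker hS hZ
  have hcont : Continuous fun Z : Matrix ν ν ℂ => intToComplex S ⊗ₖ Z :=
    continuous_matrix fun p q => continuous_const.mul (continuous_id.matrix_elem p.2 q.2)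
  have hfc : ContinuousOn f {Z | IsSiegel Z} :=
    ContinuousOn.comp (t := {Ω | IsSiegel Ω}) hc hcont.continuousOn hmaps
  have hgc : ContinuousOn g {Z | IsSiegel Z} :=
    ((continuous_const.mul continuous_id.matrix_det).pow k).continuousOn
  have hsq : Set.EqOn (f ^ 2) (g ^ 2) {Z | IsSiegel Z} := by
    intro Z hZ
    simp only [Pi.pow_apply, hf, hg]
    rw [(hκ _ (hmaps Z hZ)).1, Matrix.det_kronecker, det_intToComplex, det_eq_one_of_posDef hS hSu,
      Fintype.card_prod, hk, ← pow_mul, mul_pow, ← pow_mul]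
    simp only [Int.cast_one, one_pow, one_mul]
    congr 2 <;> ring
  have hI : IsSiegel (Complex.I • (1 : Matrix ν ν ℂ)) := isSiegel_smul_one ν (by simp)
  have hfI : f (Complex.I • 1) = g (Complex.I • 1) := by
    have h := theta_inversion_of_factor hS hSt hSu hI (hκ _ (hmaps _ hI)).2 0
    have hinv : -(Complex.I • (1 : Matrix ν ν ℂ))⁻¹ = Complex.I • 1 := by
      rw [Matrix.inv_eq_left_inv (B := -Complex.I • (1 : Matrix ν ν ℂ))]
      · simp
      · simp [smul_smul]
    rw [hinv] at h
    simp only [Matrix.transpose_zero, Matrix.zero_mul, Matrix.mul_zero, Matrix.trace_zero, mul_zero,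
      Complex.exp_zero, mul_one] at h
    have h1 : f (Complex.I • 1) = 1 :=
      (mul_eq_right₀ (tsum_thetaExp_I_ne_zero hS hSt)).mp h.symm
    rw [h1, hg]
    simp [← mul_pow]
  have := IsPreconnected.eq_of_sq_eq (convex_setOf_isSiegel ν).isPreconnected hfc hgc hsq
    (fun {Z} hZ => pow_ne_zero _ (mul_ne_zero (pow_ne_zero _ (by simp)) hZ.isUnit_det.ne_zero))
    hI hfI hZ
  have h2 := (hκ _ (hmaps Z hZ)).2
  rw [hf] at this
  simp only at this
  rwa [this] at h2

theorem tsum_thetaExp_neg_inv {S : Matrix ρ ρ ℤ}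
    (hS : (S.map (fun a : ℤ => (a : ℝ))).PosDef) (hSt : Sᵀ = S) (hSu : IsUnit S.det)
    {k : ℕ} (hk : Fintype.card ρ = 2 * k) {Z : Matrix ν ν ℂ} (hZ : IsSiegel Z) :
    ∑' L : Matrix ρ ν ℤ, thetaExp S (-Z⁻¹) L =
      ((-Complex.I) ^ Fintype.card ν * Z.det) ^ k * ∑' L : Matrix ρ ν ℤ, thetaExp S Z L := by
  simpa using theta_inversion_of_factor hS hSt hSu hZ
    (isInversionFactor_kronecker hS hSt hSu hk hZ) 0

/-- The relation of order three between inversion and translation by one, evaluated along the orbit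
`i`, `1 + i`, `(1 + i) / 2`, shows that the constant in the inversion formula is trivial. In one
variable this is the divisibility by `8` of the rank of an even unimodular lattice. -/
theorem neg_I_pow_eq_one {S : Matrix ρ ρ ℤ}
    (hS : (S.map (fun a : ℤ => (a : ℝ))).PosDef) (hSt : Sᵀ = S) (hSu : IsUnit S.det)
    (hSe : ∀ i, Even (S i i)) {k : ℕ} (hk : Fintype.card ρ = 2 * k) (ν : Type*) [Fintype ν] :
    (-Complex.I) ^ (Fintype.card ν * k) = 1 := by
  classical
  set θ : ℂ → ℂ := fun z => ∑' L : Matrix ρ ν ℤ, thetaExp S (z • 1) L with hθ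
  set N := Fintype.card ν * k with hN
  have key : ∀ z z' : ℂ, 0 < z.im → z' = 1 - 1 / z → θ z' = (-Complex.I * z) ^ N * θ z := by
    intro z z' hz hz'
    have h0 : z ≠ 0 := by rintro rfl; simp at hz
    have h := tsum_thetaExp_neg_inv hS hSt hSu hk (isSiegel_smul_one ν hz)
    have hinv : (z • (1 : Matrix ν ν ℂ))⁻¹ = z⁻¹ • 1 :=
      Matrix.inv_eq_left_inv (by simp [smul_smul, h0])
    rw [Matrix.det_smul, Matrix.det_one, mul_one, ← mul_pow, ← pow_mul, hinv] at h
    rw [hθ]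
    simp only
    rw [← h]
    refine tsum_congr fun L => ?_
    rw [← thetaExp_add_intToComplex hSt hSe (Matrix.transpose_one (n := ν)) (-(z⁻¹ • 1)) L,
      intToComplex_one, hz', sub_smul, one_smul, one_div]
    congr 1
    abel
  have h1 := key Complex.I (1 + Complex.I) (by simp) (by simp [sub_eq_add_neg])
  have h2 := key (1 + Complex.I) ((1 + Complex.I) / 2) (by simp) (by
    have : (1 + Complex.I) ≠ 0 := fun h => by simpa using congrArg Complex.im h
    field_simp
    linear_combination Complex.I_sq)
  have h3 := key ((1 + Complex.I) / 2) Complex.I (by simp) (by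
    have : (1 + Complex.I) ≠ 0 := fun h => by simpa using congrArg Complex.im h
    field_simp
    linear_combination Complex.I_sq)
  rw [h2, h1, ← mul_assoc, ← mul_assoc, ← mul_pow, ← mul_pow] at h3
  have h4 := (mul_eq_right₀ (tsum_thetaExp_I_ne_zero (ν := ν) hS hSt)).mp h3.symm
  rw [← h4]
  congr 1
  linear_combination (Complex.I ^ 4 + 2 * Complex.I ^ 3 - 2 * Complex.I) / 2 * Complex.I_sq

end

/-! ### Pluriharmonic coefficients and the inversion -/

section

variable {I : Type*} {E b : I → ℂ}

/-- The weights `E i` decay faster than every exponential in the frequencies `b i`. -/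
def ExpSummable (E b : I → ℂ) : Prop :=
  ∀ C : ℝ, Summable fun i => ‖E i‖ * Real.exp (C * ‖b i‖)

theorem ExpSummable.mul_pow (h : ExpSummable E b) (l : ℕ) :
    ExpSummable (fun i => E i * b i ^ l) b := by
  intro C
  refine Summable.of_nonneg_of_le (fun _ => by positivity) (fun i => ?_)
    ((h (C + 1)).mul_left (l.factorial : ℝ))
  have h1 := Real.pow_div_factorial_le_exp (‖b i‖) (norm_nonneg _) l
  rw [div_le_iff₀ (by positivity)] at h1
  rw [norm_mul, norm_pow, add_mul, one_mul, Real.exp_add]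
  calc ‖E i‖ * ‖b i‖ ^ l * Real.exp (C * ‖b i‖)
      ≤ ‖E i‖ * (Real.exp ‖b i‖ * l.factorial) * Real.exp (C * ‖b i‖) := by gcongr
    _ = _ := by ring

theorem ExpSummable.summable (h : ExpSummable E b) : Summable E := by
  have := h 0
  simp only [zero_mul, Real.exp_zero, mul_one] at this
  exact this.of_norm

theorem ExpSummable.summable_mul_exp (h : ExpSummable E b) (t : ℂ) :
    Summable fun i => E i * Complex.exp (t * b i) := by
  refine Summable.of_norm_bounded (h ‖t‖) fun i => ?_
  rw [norm_mul, Complex.norm_exp]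
  gcongr
  exact (Complex.re_le_norm _).trans (norm_mul _ _).le

theorem ExpSummable.hasDerivAt (h : ExpSummable E b) (t : ℂ) :
    HasDerivAt (fun t => ∑' i, E i * Complex.exp (t * b i))
      (∑' i, E i * b i ^ 1 * Complex.exp (t * b i)) t := by
  refine hasDerivAt_tsum_of_isPreconnected (t := Metric.ball (0 : ℂ) (‖t‖ + 1)) (y₀ := 0)
    (g := fun i t => E i * Complex.exp (t * b i))
    (g' := fun i t => E i * b i ^ 1 * Complex.exp (t * b i))
    (h.mul_pow 1 (‖t‖ + 1)) Metric.isOpen_ball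
    (convex_ball _ _).isPreconnected (fun i s _ => ?_) (fun i s hs => ?_)
    (Metric.mem_ball_self (by positivity)) (h.summable_mul_exp 0) (by simp)
  · have h1 := (((hasDerivAt_id s).mul_const (b i)).cexp).const_mul (E i)
    have e : E i * b i ^ 1 * Complex.exp (s * b i) =
        E i * (Complex.exp (id s * b i) * (1 * b i)) := by rw [id]; ring
    rw [e]
    exact h1
  · rw [norm_mul, Complex.norm_exp]
    gcongr
    refine (Complex.re_le_norm _).trans ?_
    rw [norm_mul]
    gcongr
    exact (mem_ball_zero_iff.mp hs).le

theorem ExpSummable.iteratedDeriv (h : ExpSummable E b) (l : ℕ) :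
    iteratedDeriv l (fun t => ∑' i, E i * Complex.exp (t * b i)) =
      fun t => ∑' i, E i * b i ^ l * Complex.exp (t * b i) := by
  induction l with
  | zero => simp
  | succ l ih =>
    rw [iteratedDeriv_succ, ih]
    ext t
    rw [((h.mul_pow l).hasDerivAt t).deriv]
    simp_rw [pow_succ, pow_zero, one_mul, mul_assoc]

theorem ExpSummable.contDiff (h : ExpSummable E b) (n : ℕ) :
    ContDiff ℂ n (fun t => ∑' i, E i * Complex.exp (t * b i)) :=
  (show Differentiable ℂ _ from fun t => (h.hasDerivAt t).differentiableAt).contDiff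

end

theorem contDiff_exp_mul_sq (β : ℂ) (n : ℕ) :
    ContDiff ℂ n (fun t : ℂ => Complex.exp (β * t ^ 2)) := by
  fun_prop

/-- The derivatives at `0` of `exp (β t²)`: those of odd order vanish, and those of order `2j` are
proportional to `β ^ j`. -/
theorem exists_iteratedDeriv_exp_mul_sq : ∃ h : ℕ → ℂ, h 0 = 1 ∧ ∀ (β : ℂ) (i : ℕ),
    iteratedDeriv i (fun t : ℂ => Complex.exp (β * t ^ 2)) 0 =
      if Even i then h i * β ^ (i / 2) else 0 := by
  set g : ℂ → ℂ := fun t => Complex.exp (t ^ 2) with hg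
  have hgc : ∀ n : ℕ, ContDiff ℂ n g := fun n => by simpa using contDiff_exp_mul_sq 1 n
  refine ⟨fun i => iteratedDeriv i g 0, by simp [hg], fun β i => ?_⟩
  obtain ⟨γ, rfl⟩ := IsAlgClosed.exists_pow_nat_eq β two_pos
  have e : (fun t : ℂ => Complex.exp (γ ^ 2 * t ^ 2)) = fun t => g (γ * t) := by
    ext t; simp [hg, mul_pow]
  rw [e, iteratedDeriv_comp_const_mul (hgc i)]
  simp only [mul_zero]
  split_ifs with hi
  · rw [← pow_mul, Nat.mul_div_cancel' hi.two_dvd, mul_comm]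
  · have h1 := iteratedDeriv_comp_neg i g 0
    have h2 : (fun t => g (-t)) = g := by ext t; simp [hg]
    rw [h2, (Nat.not_even_iff_odd.mp hi).neg_one_pow, neg_zero, neg_smul, one_smul,
      self_eq_neg] at h1
    rw [h1, mul_zero]

section

variable {ρ ν : Type*} [Fintype ρ] [Fintype ν]

/-- A function of a `ρ × ν` matrix which is a combination of `d`-th powers of the linear forms
`x ↦ tr (wᵀ x)`, such that all the contractions of this combination with the quadratic forms
`w ↦ tr (S⁻¹ w Y wᵀ)` vanish. For a combination of powers this expresses that the function is
annihilated by the operators dual to these quadratic forms. -/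
def IsPluriharmonicPowerSum [DecidableEq ρ] (S : Matrix ρ ρ ℤ) (d : ℕ)
    (Q : Matrix ρ ν ℂ → ℂ) : Prop :=
  ∃ (N : ℕ) (a : Fin N → ℂ) (w : Fin N → Matrix ρ ν ℂ),
    (∀ x, Q x = ∑ r, a r * ((w r)ᵀ * x).trace ^ d) ∧
    ∀ (Y : Matrix ν ν ℂ) (x : Matrix ρ ν ℂ) (j : ℕ), 1 ≤ j → 2 * j ≤ d →
      ∑ r, a r * ((intToComplex S)⁻¹ * w r * Y * (w r)ᵀ).trace ^ j *
        ((w r)ᵀ * x).trace ^ (d - 2 * j) = 0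

theorem IsPluriharmonicPowerSum.comp_mul_right [DecidableEq ρ] {S : Matrix ρ ρ ℤ} {d : ℕ}
    {Q : Matrix ρ ν ℂ → ℂ} (h : IsPluriharmonicPowerSum S d Q) (R : Matrix ν ν ℂ) :
    IsPluriharmonicPowerSum S d fun x : Matrix ρ ν ℂ => Q (x * R) := by
  obtain ⟨N, a, w, h1, h2⟩ := h
  have htr : ∀ (r : Fin N) (x : Matrix ρ ν ℂ),
      ((w r * Rᵀ)ᵀ * x).trace = ((w r)ᵀ * (x * R)).trace := by
    intro r x
    rw [Matrix.transpose_mul, Matrix.transpose_transpose, Matrix.mul_assoc, Matrix.trace_mul_comm,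
      Matrix.mul_assoc]
  refine ⟨N, a, fun r => w r * Rᵀ, fun x => ?_, fun Y x j hj hjd => ?_⟩
  · simp_rw [htr]; exact h1 _
  · simp_rw [htr]
    have := h2 (Rᵀ * Y * R) (x * R) j hj hjd
    simpa only [Matrix.transpose_mul, Matrix.transpose_transpose, Matrix.mul_assoc] using this

theorem norm_trace_mul_intToComplex_le (w : Matrix ρ ν ℂ) (L : Matrix ρ ν ℤ) :
    ‖(wᵀ * intToComplex L).trace‖ ≤ (∑ a, ∑ i, ‖w a i‖) * ∑ a, ∑ i, |(L a i : ℝ)| := by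
  have e : (wᵀ * intToComplex L).trace = ∑ p : ρ × ν, w p.1 p.2 * (L p.1 p.2 : ℂ) := by
    rw [Fintype.sum_prod_type, Finset.sum_comm]
    rfl
  rw [e, ← Fintype.sum_prod_type', ← Fintype.sum_prod_type', Finset.mul_sum]
  refine (norm_sum_le _ _).trans (Finset.sum_le_sum fun p _ => ?_)
  rw [norm_mul, Complex.norm_intCast]
  gcongr
  exact Finset.single_le_sum (f := fun p : ρ × ν => ‖w p.1 p.2‖) (fun _ _ => norm_nonneg _)
    (Finset.mem_univ p)

theorem expSummable_thetaExp {S : Matrix ρ ρ ℤ}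
    (hS : (S.map (fun a : ℤ => (a : ℝ))).PosDef) (hSt : Sᵀ = S) {Z : Matrix ν ν ℂ}
    (hZ : IsSiegel Z) (w : Matrix ρ ν ℂ) :
    ExpSummable (thetaExp S Z) fun L => (wᵀ * intToComplex L).trace := by
  intro C
  refine Summable.of_nonneg_of_le (fun _ => by positivity) (fun L => ?_)
    (summable_thetaExp_mul_exp hS hSt hZ (|C| * ∑ a, ∑ i, ‖w a i‖))
  refine mul_le_mul_of_nonneg_left (Real.exp_le_exp.mpr ?_) (norm_nonneg _)
  calc C * ‖(wᵀ * intToComplex L).trace‖ ≤ |C| * ‖(wᵀ * intToComplex L).trace‖ := by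
        gcongr; exact le_abs_self C
    _ ≤ |C| * ((∑ a, ∑ i, ‖w a i‖) * ∑ a, ∑ i, |(L a i : ℝ)|) := by
        gcongr; exact norm_trace_mul_intToComplex_le w L
    _ = _ := by ring

theorem IsPluriharmonicPowerSum.summable [DecidableEq ρ] {S : Matrix ρ ρ ℤ}
    (hS : (S.map (fun a : ℤ => (a : ℝ))).PosDef) (hSt : Sᵀ = S) {Z : Matrix ν ν ℂ}
    (hZ : IsSiegel Z) {d : ℕ} {Q : Matrix ρ ν ℂ → ℂ} (hQ : IsPluriharmonicPowerSum S d Q) :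
    Summable fun L => Q (intToComplex L) * thetaExp S Z L := by
  obtain ⟨N, a, w, h1, -⟩ := hQ
  have : ∀ r, Summable fun L : Matrix ρ ν ℤ =>
      a r * (thetaExp S Z L * ((w r)ᵀ * intToComplex L).trace ^ d) := fun r =>
    ((expSummable_thetaExp hS hSt hZ (w r)).mul_pow d).summable.mul_left _
  refine (summable_sum (s := Finset.univ) fun r _ => this r).congr fun L => ?_
  rw [h1, Finset.sum_mul]
  exact Finset.sum_congr rfl fun r _ => by ring

/-- Inversion of the theta series with pluriharmonic coefficients. The `d`-th derivatives at `t = 0`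
of the inversion formula at the points `t w r` are combined; all terms in which the Gaussian factor
is differentiated cancel by pluriharmonicity. -/
theorem IsPluriharmonicPowerSum.tsum_neg_inv [DecidableEq ρ] [DecidableEq ν] {S : Matrix ρ ρ ℤ}
    (hS : (S.map (fun a : ℤ => (a : ℝ))).PosDef) (hSt : Sᵀ = S) (hSu : IsUnit S.det)
    {Z : Matrix ν ν ℂ} (hZ : IsSiegel Z) {κ : ℂ}
    (hκ : IsInversionFactor (intToComplex S ⊗ₖ Z) κ) {d : ℕ} {Q : Matrix ρ ν ℂ → ℂ}
    (hQ : IsPluriharmonicPowerSum S d Q) :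
    ∑' N : Matrix ρ ν ℤ, Q (intToComplex N * Z⁻¹) * thetaExp S (-Z⁻¹) N =
      κ * ∑' L : Matrix ρ ν ℤ, Q (intToComplex L) * thetaExp S Z L := by
  obtain ⟨R, a, w, h1, h2⟩ := hQ
  obtain ⟨h, hh0, hh⟩ := exists_iteratedDeriv_exp_mul_sq
  set c : ℂ := 2 * Real.pi * Complex.I with hc
  have hc0 : c ≠ 0 := Complex.two_pi_I_ne_zero
  set q : Fin R → ℂ := fun r => ((intToComplex S)⁻¹ * w r * Z⁻¹ * (w r)ᵀ).trace with hq
  -- the linear forms on both sides; the scalar `c` is absorbed into the vectors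
  set b : Fin R → Matrix ρ ν ℤ → ℂ := fun r L => ((c • w r)ᵀ * intToComplex L).trace with hb
  set b' : Fin R → Matrix ρ ν ℤ → ℂ :=
    fun r N => ((c • (w r * (Z⁻¹)ᵀ))ᵀ * intToComplex N).trace with hb'
  have hbc : ∀ r L, b r L = c * ((w r)ᵀ * intToComplex L).trace := fun r L => by
    simp [hb]
  have hbc' : ∀ r N, b' r N = c * ((w r)ᵀ * (intToComplex N * Z⁻¹)).trace := fun r N => by
    rw [hb']
    simp only
    rw [Matrix.transpose_smul, Matrix.smul_mul, Matrix.trace_smul, smul_eq_mul,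
      Matrix.transpose_mul, Matrix.transpose_transpose, Matrix.mul_assoc, Matrix.trace_mul_comm,
      Matrix.mul_assoc]
  have hE : ∀ r, ExpSummable (thetaExp S Z) (b r) := fun r => expSummable_thetaExp hS hSt hZ _
  have hE' : ∀ r, ExpSummable (thetaExp S (-Z⁻¹)) (b' r) := fun r =>
    expSummable_thetaExp hS hSt hZ.neg_inv _
  have hfun : ∀ r, (fun t => ∑' N, thetaExp S (-Z⁻¹) N * Complex.exp (t * b' r N)) =
      fun t => κ * ((fun t => Complex.exp (Real.pi * Complex.I * q r * t ^ 2)) *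
        (fun t => ∑' L, thetaExp S Z L * Complex.exp (t * b r L))) t := by
    intro r
    ext t
    have := theta_inversion_of_factor hS hSt hSu hZ hκ (t • w r)
    simp only [Pi.mul_apply, hbc, hbc']
    simp only [Matrix.transpose_smul, Matrix.smul_mul, Matrix.mul_smul, Matrix.trace_smul,
      smul_eq_mul] at this
    simp_rw [mul_left_comm t c]
    have e3 : Real.pi * Complex.I * (t * (t * q r)) = Real.pi * Complex.I * q r * t ^ 2 := by ring
    simp only [hq] at e3 ⊢
    rw [this, e3, mul_assoc]
  have hderiv : ∀ r, ∑' N, thetaExp S (-Z⁻¹) N * b' r N ^ d =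
      κ * ∑ i ∈ Finset.range (d + 1), d.choose i *
        (if Even i then h i * (Real.pi * Complex.I * q r) ^ (i / 2) else 0) *
        ∑' L, thetaExp S Z L * b r L ^ (d - i) := by
    intro r
    have e := congrArg (fun f => iteratedDeriv d f 0) (hfun r)
    rw [(hE' r).iteratedDeriv, iteratedDeriv_const_mul_field,
      iteratedDeriv_mul (contDiff_exp_mul_sq _ d).contDiffAt ((hE r).contDiff d).contDiffAt] at e
    simpa only [hh, (hE r).iteratedDeriv, zero_mul, Complex.exp_zero, mul_one] using e
  have hsum : ∀ r l, Summable fun L => thetaExp S Z L * b r L ^ l := fun r l =>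
    ((hE r).mul_pow l).summable
  have hmain : ∑ r, a r * ∑' N, thetaExp S (-Z⁻¹) N * b' r N ^ d =
      κ * ∑ r, a r * ∑' L, thetaExp S Z L * b r L ^ d := by
    simp_rw [hderiv, mul_left_comm _ κ]
    rw [← Finset.mul_sum]
    congr 1
    simp_rw [Finset.mul_sum]
    rw [Finset.sum_comm, Finset.sum_eq_single_of_mem 0 (by simp)]
    · simp [hh0]
    · intro i hi hi0
      split_ifs with hev
      · obtain ⟨j, rfl⟩ := hev
        rw [← two_mul] at *
        have hj : 2 * j / 2 = j := by omega
        have hjd : 2 * j ≤ d := by have := Finset.mem_range.mp hi; omega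
        have e : ∀ r, a r * (d.choose (2 * j) * (h (2 * j) * (Real.pi * Complex.I * q r) ^ (2 * j / 2)) *
            ∑' L, thetaExp S Z L * b r L ^ (d - 2 * j)) =
            ∑' L, (d.choose (2 * j) * h (2 * j) * (Real.pi * Complex.I) ^ j * c ^ (d - 2 * j) *
              thetaExp S Z L) * (a r * q r ^ j *
                ((w r)ᵀ * intToComplex L).trace ^ (d - 2 * j)) := by
          intro r
          rw [hj, ← tsum_mul_left, ← tsum_mul_left]
          refine tsum_congr fun L => ?_
          rw [hbc, mul_pow, mul_pow]
          ring
        simp_rw [e]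
        rw [← Summable.tsum_finsetSum]
        · simp_rw [← Finset.mul_sum]
          have h3 := fun L => h2 Z⁻¹ (intToComplex L) j (by omega) hjd
          simp only [hq, h3, mul_zero, tsum_zero]
        · intro r _
          refine ((hsum r (d - 2 * j)).mul_left (d.choose (2 * j) * h (2 * j) *
            (Real.pi * Complex.I) ^ j * a r * q r ^ j)).congr fun L => ?_
          rw [hbc, mul_pow]
          ring
      · simp
  have hl : ∑ r, a r * ∑' N, thetaExp S (-Z⁻¹) N * b' r N ^ d =
      c ^ d * ∑' N : Matrix ρ ν ℤ, Q (intToComplex N * Z⁻¹) * thetaExp S (-Z⁻¹) N := by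
    simp_rw [← tsum_mul_left]
    rw [← Summable.tsum_finsetSum fun r _ => (((hE' r).mul_pow d).summable).mul_left _]
    refine tsum_congr fun N => ?_
    rw [h1, Finset.sum_mul, Finset.mul_sum]
    refine Finset.sum_congr rfl fun r _ => ?_
    rw [hbc', mul_pow]
    ring
  have hr : ∑ r, a r * ∑' L, thetaExp S Z L * b r L ^ d =
      c ^ d * ∑' L : Matrix ρ ν ℤ, Q (intToComplex L) * thetaExp S Z L := by
    simp_rw [← tsum_mul_left]
    rw [← Summable.tsum_finsetSum fun r _ => (hsum r d).mul_left _]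
    refine tsum_congr fun L => ?_
    rw [h1, Finset.sum_mul, Finset.mul_sum]
    refine Finset.sum_congr rfl fun r _ => ?_
    rw [hbc, mul_pow]
    ring
  rw [hl, hr, mul_left_comm] at hmain
  exact mul_left_cancel₀ (pow_ne_zero d hc0) hmain

end

/-! ### The transformation law and its generators -/

section

variable {ρ : Type*} [Fintype ρ] [DecidableEq ρ] {n : ℕ}

/-- The theta transformation law of `M` for all pluriharmonic coefficient functions, together with
the fact that `M` acts on the Siegel space. All coefficient functions `Q` are included because the
law of a product of matrices for `Q` uses the law of a factor for `x ↦ Q (x * R)`. -/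
def ThetaLaw (S : Matrix ρ ρ ℤ) (k : ℕ) (M : Matrix (Fin n ⊕ Fin n) (Fin n ⊕ Fin n) ℤ) : Prop :=
  ∀ Z : Matrix (Fin n) (Fin n) ℂ, IsSiegel Z →
    IsUnit (siegelDenom M Z).det ∧ IsSiegel (siegelNum M Z * (siegelDenom M Z)⁻¹) ∧
    ∀ (d : ℕ) (Q : Matrix ρ (Fin n) ℂ → ℂ), IsPluriharmonicPowerSum S d Q →
      ∑' L : Matrix ρ (Fin n) ℤ, Q (intToComplex L * ((siegelDenom M Z)⁻¹)ᵀ) *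
          thetaExp S (siegelNum M Z * (siegelDenom M Z)⁻¹) L =
        (siegelDenom M Z).det ^ k * ∑' L : Matrix ρ (Fin n) ℤ, Q (intToComplex L) * thetaExp S Z L

theorem siegelDenom_fromBlocks (A B C D : Matrix (Fin n) (Fin n) ℤ) (Z : Matrix (Fin n) (Fin n) ℂ) :
    siegelDenom (Matrix.fromBlocks A B C D) Z = intToComplex C * Z + intToComplex D := rfl

theorem siegelNum_fromBlocks (A B C D : Matrix (Fin n) (Fin n) ℤ) (Z : Matrix (Fin n) (Fin n) ℂ) :
    siegelNum (Matrix.fromBlocks A B C D) Z = intToComplex A * Z + intToComplex B := rfl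

/-- The cocycle relation for the factor `C Z + D`, and its analogue for `A Z + B`. -/
theorem siegelDenom_siegelNum_mul (M₁ M₂ : Matrix (Fin n ⊕ Fin n) (Fin n ⊕ Fin n) ℤ)
    {Z : Matrix (Fin n) (Fin n) ℂ} (h : IsUnit (siegelDenom M₂ Z).det) :
    siegelDenom (M₁ * M₂) Z =
      siegelDenom M₁ (siegelNum M₂ Z * (siegelDenom M₂ Z)⁻¹) * siegelDenom M₂ Z ∧
    siegelNum (M₁ * M₂) Z =
      siegelNum M₁ (siegelNum M₂ Z * (siegelDenom M₂ Z)⁻¹) * siegelDenom M₂ Z := by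
  have key : ∀ X Y : Matrix (Fin n) (Fin n) ℂ,
      (X * (siegelNum M₂ Z * (siegelDenom M₂ Z)⁻¹) + Y) * siegelDenom M₂ Z =
        X * siegelNum M₂ Z + Y * siegelDenom M₂ Z := fun X Y => by
    rw [Matrix.add_mul, Matrix.mul_assoc, Matrix.mul_assoc, Matrix.nonsing_inv_mul _ h,
      Matrix.mul_one]
  have hblocks : ∀ M : Matrix (Fin n ⊕ Fin n) (Fin n ⊕ Fin n) ℤ,
      ∃ A B C D, M = Matrix.fromBlocks A B C D := fun M =>
    ⟨_, _, _, _, (Matrix.fromBlocks_toBlocks M).symm⟩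
  obtain ⟨A, B, C, D, rfl⟩ := hblocks M₁
  rw [siegelDenom_fromBlocks, siegelNum_fromBlocks A, key, key]
  obtain ⟨A', B', C', D', rfl⟩ := hblocks M₂
  rw [Matrix.fromBlocks_multiply]
  simp only [siegelDenom_fromBlocks, siegelNum_fromBlocks, intToComplex_add, intToComplex_mul,
    Matrix.add_mul, Matrix.mul_add, Matrix.mul_assoc]
  constructor <;> abel

theorem ThetaLaw.one (S : Matrix ρ ρ ℤ) (k : ℕ) :
    ThetaLaw S k (1 : Matrix (Fin n ⊕ Fin n) (Fin n ⊕ Fin n) ℤ) := by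
  intro Z hZ
  rw [← Matrix.fromBlocks_one, siegelDenom_fromBlocks, siegelNum_fromBlocks]
  simp [intToComplex_one, intToComplex_zero, hZ]

theorem ThetaLaw.mul {S : Matrix ρ ρ ℤ} {k : ℕ}
    {M₁ M₂ : Matrix (Fin n ⊕ Fin n) (Fin n ⊕ Fin n) ℤ} (h₁ : ThetaLaw S k M₁)
    (h₂ : ThetaLaw S k M₂) : ThetaLaw S k (M₁ * M₂) := by
  intro Z hZ
  obtain ⟨hu₂, hs₂, hl₂⟩ := h₂ Z hZ
  obtain ⟨hu₁, hs₁, hl₁⟩ := h₁ _ hs₂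
  obtain ⟨hd, hn⟩ := siegelDenom_siegelNum_mul M₁ M₂ hu₂
  have hact : siegelNum (M₁ * M₂) Z * (siegelDenom (M₁ * M₂) Z)⁻¹ =
      siegelNum M₁ (siegelNum M₂ Z * (siegelDenom M₂ Z)⁻¹) *
        (siegelDenom M₁ (siegelNum M₂ Z * (siegelDenom M₂ Z)⁻¹))⁻¹ := by
    rw [hd, hn, Matrix.mul_inv_rev, Matrix.mul_assoc, ← Matrix.mul_assoc (siegelDenom M₂ Z),
      Matrix.mul_nonsing_inv _ hu₂, Matrix.one_mul]
  rw [hact, hd]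
  refine ⟨by rw [Matrix.det_mul]; exact hu₁.mul hu₂, hs₁, fun d Q hQ => ?_⟩
  have e := hl₁ d _ (hQ.comp_mul_right ((siegelDenom M₂ Z)⁻¹)ᵀ)
  beta_reduce at e
  rw [hl₂ d Q hQ] at e
  rw [Matrix.det_mul, mul_pow, mul_assoc, ← e, Matrix.mul_inv_rev, Matrix.transpose_mul]
  simp only [Matrix.mul_assoc]

/-- The integral matrices satisfying the theta transformation law. -/
def thetaSubmonoid (S : Matrix ρ ρ ℤ) (k n : ℕ) :
    Submonoid (Matrix (Fin n ⊕ Fin n) (Fin n ⊕ Fin n) ℤ) where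
  carrier := {M | ThetaLaw S k M}
  one_mem' := ThetaLaw.one S k
  mul_mem' := ThetaLaw.mul

theorem ThetaLaw.translation {S : Matrix ρ ρ ℤ} (hSt : Sᵀ = S) (hSe : ∀ i, Even (S i i)) (k : ℕ)
    {B : Matrix (Fin n) (Fin n) ℤ} (hB : Bᵀ = B) :
    ThetaLaw S k (Matrix.fromBlocks 1 B 0 1) := by
  intro Z hZ
  rw [siegelDenom_fromBlocks, siegelNum_fromBlocks]
  simp only [intToComplex_one, intToComplex_zero, Matrix.zero_mul, zero_add,
    inv_one, Matrix.mul_one, Matrix.det_one, isUnit_one, one_pow, one_mul, Matrix.transpose_one,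
    thetaExp_add_intToComplex hSt hSe hB, true_and, implies_true, and_true]
  refine ⟨?_, ?_⟩
  · rw [Matrix.transpose_add, hZ.1, ← intToComplex_transpose, hB]
  · convert hZ.2 using 1
    ext i j
    simp [intToComplex]

theorem IsSiegel.mul_mul_transpose {Z : Matrix (Fin n) (Fin n) ℂ} (hZ : IsSiegel Z)
    {U V : Matrix (Fin n) (Fin n) ℤ} (hUV : U * Vᵀ = 1) :
    IsSiegel (intToComplex U * Z * (intToComplex U)ᵀ) := by
  refine IsSiegel.of_im_pos (by simp [Matrix.transpose_mul, hZ.1, Matrix.mul_assoc]) fun x hx => ?_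
  set X : Fin n → ℂ := Complex.ofReal ∘ x with hX
  have hX0 : (intToComplex U)ᵀ *ᵥ X ≠ 0 := by
    intro h0
    have h1 : X = 0 := by
      have h2 : V * Uᵀ = 1 := by
        rw [← Matrix.transpose_one, ← hUV, Matrix.transpose_mul, Matrix.transpose_transpose]
      have h3 : intToComplex V * (intToComplex U)ᵀ = 1 := by
        rw [← intToComplex_transpose, ← intToComplex_mul, h2, intToComplex_one]
      rw [← Matrix.one_mulVec X, ← h3, ← Matrix.mulVec_mulVec, h0, Matrix.mulVec_zero]
    apply hx
    ext a
    simpa [hX] using congrFun h1 a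
  have h := hZ.im_star_form_pos hX0
  have hstar : star ((intToComplex U)ᵀ *ᵥ X) = (intToComplex U)ᵀ *ᵥ X := by
    ext a
    simp [Matrix.mulVec, dotProduct, hX, intToComplex]
  rw [hstar] at h
  have e : X ⬝ᵥ (intToComplex U * Z * (intToComplex U)ᵀ) *ᵥ X =
      (intToComplex U)ᵀ *ᵥ X ⬝ᵥ Z *ᵥ ((intToComplex U)ᵀ *ᵥ X) := by
    rw [← Matrix.mulVec_mulVec, ← Matrix.mulVec_mulVec, dotProduct_mulVec_transpose, dotProduct_comm]
  rwa [e]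

/-- The law for the block diagonal matrices, by the substitution `L ↦ L U` in the sum. Since `k` is
even, the sign `det V ^ k` is trivial. -/
theorem ThetaLaw.levi {S : Matrix ρ ρ ℤ} {k : ℕ} (hk : Even k)
    {U V : Matrix (Fin n) (Fin n) ℤ} (hUV : U * Vᵀ = 1) :
    ThetaLaw S k (Matrix.fromBlocks U 0 0 V) := by
  intro Z hZ
  have hVU : V * Uᵀ = 1 := by
    rw [← Matrix.transpose_one, ← hUV, Matrix.transpose_mul, Matrix.transpose_transpose]
  have hVc : intToComplex V * (intToComplex U)ᵀ = 1 := by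
    rw [← intToComplex_transpose, ← intToComplex_mul, hVU, intToComplex_one]
  have hinv : (intToComplex V)⁻¹ = (intToComplex U)ᵀ := Matrix.inv_eq_right_inv hVc
  have hU : IsUnit U.det := Matrix.isUnit_det_of_right_inverse hUV
  have hV : IsUnit V.det := Matrix.isUnit_det_of_right_inverse hVU
  rw [siegelDenom_fromBlocks, siegelNum_fromBlocks]
  simp only [intToComplex_zero, Matrix.zero_mul, zero_add, add_zero, hinv,
    Matrix.transpose_transpose]
  refine ⟨?_, hZ.mul_mul_transpose hUV, fun d Q _ => ?_⟩
  · rw [det_intToComplex]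
    exact hV.map (Int.castRingHom ℂ)
  · have hdet : (intToComplex V).det ^ k = 1 := by
      rw [det_intToComplex]
      rcases Int.isUnit_iff.mp hV with h | h <;> simp [h, hk.neg_one_pow]
    rw [hdet, one_mul, ← (mulRightEquiv ρ U hU).tsum_eq (fun L => Q (intToComplex L) * _)]
    refine tsum_congr fun L => ?_
    have e : (mulRightEquiv ρ U hU) L = L * U := rfl
    rw [e, intToComplex_mul, thetaExp, thetaExp, Matrix.transpose_mul, intToComplex_mul,
      intToComplex_mul, intToComplex_mul, intToComplex_mul, intToComplex_transpose U]
    simp only [Matrix.mul_assoc]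

theorem ThetaLaw.inversion {S : Matrix ρ ρ ℤ}
    (hS : (S.map (fun a : ℤ => (a : ℝ))).PosDef) (hSt : Sᵀ = S) (hSu : IsUnit S.det)
    (hSe : ∀ i, Even (S i i)) {k : ℕ} (hk : Fintype.card ρ = 2 * k) :
    ThetaLaw S k (Matrix.fromBlocks 0 (-1) 1 0 : Matrix (Fin n ⊕ Fin n) (Fin n ⊕ Fin n) ℤ) := by
  intro Z hZ
  rw [siegelDenom_fromBlocks, siegelNum_fromBlocks]
  simp only [intToComplex_zero, intToComplex_one, intToComplex_neg, Matrix.zero_mul, zero_add,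
    add_zero, Matrix.one_mul, Matrix.neg_mul, hZ.inv_transpose]
  refine ⟨hZ.isUnit_det, hZ.neg_inv, fun d Q hQ => ?_⟩
  rw [hQ.tsum_neg_inv hS hSt hSu hZ (isInversionFactor_kronecker hS hSt hSu hk hZ), mul_pow,
    ← pow_mul, neg_I_pow_eq_one hS hSt hSu hSe hk (Fin n), one_mul]

/-- The lower triangular unipotent matrices are conjugate under the inversion to translations. -/
theorem ThetaLaw.lower {S : Matrix ρ ρ ℤ}
    (hS : (S.map (fun a : ℤ => (a : ℝ))).PosDef) (hSt : Sᵀ = S) (hSu : IsUnit S.det)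
    (hSe : ∀ i, Even (S i i)) {k : ℕ} (hk : Fintype.card ρ = 2 * k) (hk2 : Even k)
    {B : Matrix (Fin n) (Fin n) ℤ} (hB : Bᵀ = B) :
    ThetaLaw S k (Matrix.fromBlocks 1 0 B 1) := by
  have hJ : ThetaLaw S k (Matrix.fromBlocks 0 (-1) 1 0) :=
    ThetaLaw.inversion (n := n) hS hSt hSu hSe hk
  have h := ((hJ.mul (ThetaLaw.translation hSt hSe k (B := -B) (by simp [hB]))).mul
    (ThetaLaw.levi (U := -1) (V := -1) hk2 (by simp))).mul hJ
  simpa [Matrix.fromBlocks_multiply] using h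

/-- Half the rank of an even unimodular positive definite lattice is even. -/
theorem even_of_posDef_unimodular {S : Matrix ρ ρ ℤ}
    (hS : (S.map (fun a : ℤ => (a : ℝ))).PosDef) (hSt : Sᵀ = S) (hSu : IsUnit S.det)
    (hSe : ∀ i, Even (S i i)) {k : ℕ} (hk : Fintype.card ρ = 2 * k) : Even k := by
  have h := neg_I_pow_eq_one hS hSt hSu hSe hk Unit
  rw [Fintype.card_unit, one_mul] at h
  by_contra hodd
  obtain ⟨j, rfl⟩ := Nat.not_even_iff_odd.mp hodd
  rw [pow_succ, pow_mul, neg_sq, Complex.I_sq] at h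
  rcases neg_one_pow_eq_or ℂ j with h1 | h1 <;> rw [h1] at h <;>
    simpa using congrArg Complex.re h

end

/-! ### Generation of the integral symplectic group -/

section

variable {ν : Type*} [Fintype ν] [DecidableEq ν]

theorem fromBlocks_one_zero_mem_symplecticGroup {B : Matrix ν ν ℤ} (hB : Bᵀ = B) :
    Matrix.fromBlocks 1 0 B 1 ∈ Matrix.symplecticGroup ν ℤ := by
  rw [SymplecticGroup.fromBlocks_mem_iff]
  simp [hB]

theorem fromBlocks_one_one_mem_symplecticGroup {B : Matrix ν ν ℤ} (hB : Bᵀ = B) :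
    Matrix.fromBlocks 1 B 0 1 ∈ Matrix.symplecticGroup ν ℤ := by
  rw [SymplecticGroup.fromBlocks_mem_iff]
  simp [hB]

/-- If `R` is a nonzero symmetric matrix with entries of absolute value at most `1/2`, then there is
a partial inversion, encoded by a symmetric matrix `E` with `E ^ 3 = E`, whose factor
`det (1 - E (E + R))` has absolute value in `(0, 1)`. If `R` has a nonzero diagonal entry, `E` is a
diagonal matrix unit and the factor is `-R i i`; otherwise `E` exchanges two coordinates `i` and `j`
with `R i j ≠ 0`, and the factor is `R i j ^ 2`. -/
theorem exists_partial_inversion {R : Matrix ν ν ℚ} (hR : Rᵀ = R) (hR0 : R ≠ 0)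
    (hle : ∀ i j, |R i j| ≤ 1 / 2) : ∃ E : Matrix ν ν ℤ, Eᵀ = E ∧ E * E * E = E ∧
      (1 - E.map (Int.cast : ℤ → ℚ) * (E.map (Int.cast : ℤ → ℚ) + R)).det ≠ 0 ∧
      |(1 - E.map (Int.cast : ℤ → ℚ) * (E.map (Int.cast : ℤ → ℚ) + R)).det| < 1 := by
  by_cases hdiag : ∃ i, R i i ≠ 0
  · obtain ⟨i, hi⟩ := hdiag
    refine ⟨Matrix.single i i 1, by simp, by simp, ?_⟩
    -- `E X` has rank one, so the determinant of `1 - E X` reduces to size one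
    set X : Matrix ν ν ℚ := (Matrix.single i i (1 : ℤ)).map (Int.cast : ℤ → ℚ) + R with hX
    have hmul : (Matrix.single i i (1 : ℤ)).map (Int.cast : ℤ → ℚ) * X =
        (Matrix.of fun a (_ : Unit) => (Pi.single i 1 : ν → ℚ) a) *
          (Matrix.of fun (_ : Unit) b => X i b) := by
      ext a b
      by_cases h : i = a <;>
        simp [Matrix.mul_apply, Matrix.single_apply, h, Pi.single_apply, eq_comm]
    have hdet : (1 - (Matrix.single i i (1 : ℤ)).map (Int.cast : ℤ → ℚ) * X).det = -R i i := by
      rw [hmul, Matrix.det_one_sub_mul_comm, Matrix.det_unique]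
      simp [Matrix.mul_apply, hX, Pi.single_apply]
    rw [hdet]
    refine ⟨neg_ne_zero.mpr hi, ?_⟩
    rw [abs_neg]
    linarith [hle i i]
  · push Not at hdiag
    obtain ⟨i, j, hij⟩ : ∃ i j, R i j ≠ 0 := by
      by_contra! h
      exact hR0 (by ext i j; exact h i j)
    have hne : i ≠ j := by rintro rfl; exact hij (hdiag i)
    have hsymm : R j i = R i j := congrFun (congrFun hR i) j
    refine ⟨Matrix.single i j 1 + Matrix.single j i 1, by simp [add_comm],
      by simp [Matrix.add_mul, Matrix.mul_add, hne, hne.symm], ?_⟩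
    set E : Matrix ν ν ℚ :=
      (Matrix.single i j (1 : ℤ) + Matrix.single j i 1).map (Int.cast : ℤ → ℚ) with hE
    -- `E (E + R)` factors through size two, since `E` only involves the rows `i` and `j`
    have hmul : E * (E + R) =
        (Matrix.of fun a (s : Fin 2) => (Pi.single (![i, j] s) 1 : ν → ℚ) a) *
          (Matrix.of fun (s : Fin 2) b => (E + R) (![j, i] s) b) := by
      have hEr : ∀ (X : Matrix ν ν ℚ) (a b : ν), (E * X) a b =
          (if i = a then X j b else 0) + (if j = a then X i b else 0) := by
        intro X a b
        have : E = Matrix.single i j 1 + Matrix.single j i 1 := by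
          ext a b
          simp [hE, Matrix.single_apply]
        rw [this, Matrix.add_mul, Matrix.add_apply]
        simp [Matrix.mul_apply, Matrix.single_apply, ite_and]
      ext a b
      rw [hEr, Matrix.mul_apply]
      simp [Fin.sum_univ_two, Pi.single_apply, eq_comm]
    have hEij : E i j = 1 := by simp [hE, hne.symm]
    have hEji : E j i = 1 := by simp [hE, hne]
    have hEii : E i i = 0 := by simp [hE, hne.symm]
    have hEjj : E j j = 0 := by simp [hE, hne]
    have hdet : (1 - E * (E + R)).det = R i j ^ 2 := by
      rw [hmul, Matrix.det_one_sub_mul_comm, Matrix.det_fin_two]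
      have hVU : ∀ s t : Fin 2, ((Matrix.of fun (s : Fin 2) b => (E + R) (![j, i] s) b) *
          (Matrix.of fun a (s : Fin 2) => (Pi.single (![i, j] s) 1 : ν → ℚ) a)) s t =
          E (![j, i] s) (![i, j] t) + R (![j, i] s) (![i, j] t) := fun s t => by
        simp [Matrix.mul_apply, Pi.single_apply]
      simp only [Matrix.sub_apply, hVU]
      simp [hEij, hEji, hEii, hEjj, hdiag, hsymm]
      ring
    rw [hdet]
    refine ⟨pow_ne_zero 2 hij, ?_⟩
    rw [abs_pow]
    have := hle i j
    have h0 := abs_nonneg (R i j)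
    nlinarith

open scoped ComplexOrder in
/-- For a symplectic matrix the polynomial `det (A + t C)` is not zero, since it does not vanish at
`t = i`. -/
theorem exists_det_add_smul_ne_zero {A B C D : Matrix ν ν ℤ}
    (h : Matrix.fromBlocks A B C D ∈ Matrix.symplecticGroup ν ℤ) :
    ∃ t : ℕ, (A + (t : ℤ) • C).det ≠ 0 := by
  obtain ⟨h1, -, h3⟩ := SymplecticGroup.fromBlocks_mem_iff.mp h
  set f := Int.castRingHom ℂ with hf
  set A' := A.map f with hA'
  set C' := C.map f with hC'
  have h1' : A'ᵀ * C' = C'ᵀ * A' := by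
    have := congrArg (fun M : Matrix ν ν ℤ => M.map f) h1
    simpa [Matrix.map_mul, Matrix.transpose_map] using this
  have h3' : (D.map f)ᵀ * A' - (B.map f)ᵀ * C' = 1 := by
    have := congrArg (fun M : Matrix ν ν ℤ => (Mᵀ).map f) h3
    simpa [Matrix.map_mul, Matrix.transpose_map, Matrix.map_sub] using this
  have hI : (A' + Complex.I • C').det ≠ 0 := by
    intro h0
    obtain ⟨v, hv, hv0⟩ := Matrix.exists_mulVec_eq_zero_iff.mpr h0
    rw [Matrix.add_mulVec, Matrix.smul_mulVec] at hv0
    have ha : A' *ᵥ v = -Complex.I • C' *ᵥ v := by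
      rw [eq_neg_of_add_eq_zero_left hv0, neg_smul]
    have hconj : ∀ M : Matrix ν ν ℤ, star (M.map f *ᵥ v) = M.map f *ᵥ star v := by
      intro M
      ext a
      simp [Matrix.mulVec, dotProduct, hf]
    have hsymm : star (A' *ᵥ v) ⬝ᵥ C' *ᵥ v = star (C' *ᵥ v) ⬝ᵥ A' *ᵥ v := by
      rw [hconj, hconj, dotProduct_comm (A' *ᵥ star v), dotProduct_comm (C' *ᵥ star v),
        Matrix.dotProduct_mulVec, Matrix.dotProduct_mulVec, ← Matrix.mulVec_transpose,
        ← Matrix.mulVec_transpose, Matrix.mulVec_mulVec, Matrix.mulVec_mulVec, h1']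
    rw [ha, star_smul, smul_dotProduct, dotProduct_smul, smul_eq_mul, smul_eq_mul] at hsymm
    have hz : star (C' *ᵥ v) ⬝ᵥ C' *ᵥ v = 0 := by
      have h2 : (2 * Complex.I) * (star (C' *ᵥ v) ⬝ᵥ C' *ᵥ v) = 0 := by
        have h4 : star (-Complex.I) = Complex.I := by simp
        rw [h4] at hsymm
        linear_combination hsymm
      simpa using h2
    have hc : C' *ᵥ v = 0 := dotProduct_star_self_eq_zero.mp hz
    have ha0 : A' *ᵥ v = 0 := by rw [ha, hc, smul_zero]
    apply hv
    rw [← Matrix.one_mulVec v, ← h3', Matrix.sub_mulVec, ← Matrix.mulVec_mulVec,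
      ← Matrix.mulVec_mulVec, ha0, hc, Matrix.mulVec_zero, Matrix.mulVec_zero, sub_zero]
  by_contra! hall
  set p : Polynomial ℂ := (A'.map Polynomial.C + (Polynomial.X : Polynomial ℂ) •
    C'.map Polynomial.C).det with hp
  have heval : ∀ t : ℂ, p.eval t = (A' + t • C').det := by
    intro t
    rw [hp, ← Polynomial.coe_evalRingHom, RingHom.map_det]
    congr 1
    ext a b
    simp [mul_comm t]
  have hp0 : p = 0 := by
    refine Polynomial.eq_zero_of_infinite_isRoot p
      ((Set.infinite_range_of_injective (Nat.cast_injective (R := ℂ))).mono ?_)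
    rintro _ ⟨t, rfl⟩
    change p.eval _ = 0
    rw [heval]
    have := congrArg f (hall t)
    rw [RingHom.map_det, map_zero] at this
    rw [← this]
    congr 1
    ext a b
    rw [RingHom.mapMatrix_apply, Matrix.map_apply, Matrix.add_apply, Matrix.add_apply,
      Matrix.smul_apply, Matrix.smul_apply]
    simp [hA', hC', hf]
  exact hI (by rw [← heval, hp0, Polynomial.eval_zero])

end

section

variable {ν : Type*} [Fintype ν] [DecidableEq ν]
  {H : Submonoid (Matrix (ν ⊕ ν) (ν ⊕ ν) ℤ)}

/-- Euclidean descent on `|det A|`: subtract the nearest integers from the symmetric matrix `C A⁻¹`,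
then apply a partial inversion, which multiplies `det A` by a minor of absolute value less
than `1`. -/
theorem mem_of_det_ne_zero
    (hT : ∀ B : Matrix ν ν ℤ, Bᵀ = B → Matrix.fromBlocks 1 B 0 1 ∈ H)
    (hL : ∀ B : Matrix ν ν ℤ, Bᵀ = B → Matrix.fromBlocks 1 0 B 1 ∈ H)
    (hU : ∀ U V : Matrix ν ν ℤ, U * Vᵀ = 1 → Matrix.fromBlocks U 0 0 V ∈ H) (N : ℕ) :
    ∀ A B C D : Matrix ν ν ℤ, Matrix.fromBlocks A B C D ∈ Matrix.symplecticGroup ν ℤ →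
      A.det ≠ 0 → A.det.natAbs = N → Matrix.fromBlocks A B C D ∈ H := by
  induction N using Nat.strong_induction_on with
  | _ N ih =>
  intro A B C D hM hA hN
  set f := Int.castRingHom ℚ with hf
  have hfinj : Function.Injective (fun M : Matrix ν ν ℤ => M.map f) :=
    fun M N h => by
      ext a b
      have := congrFun (congrFun h a) b
      simpa [hf] using this
  have hAu : IsUnit (A.map f).det := by
    rw [isUnit_iff_ne_zero, ← RingHom.mapMatrix_apply, ← RingHom.map_det]
    simpa [hf] using hA
  obtain ⟨h1, -, -⟩ := SymplecticGroup.fromBlocks_mem_iff.mp hM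
  set R : Matrix ν ν ℚ := C.map f * (A.map f)⁻¹ with hR
  have hRA : R * A.map f = C.map f := by
    rw [hR, Matrix.mul_assoc, Matrix.nonsing_inv_mul _ hAu, Matrix.mul_one]
  have hRsymm : Rᵀ = R := by
    have h1' : (A.map f)ᵀ * C.map f = (C.map f)ᵀ * A.map f := by
      have := congrArg (fun M : Matrix ν ν ℤ => M.map f) h1
      simpa [Matrix.map_mul, Matrix.transpose_map] using this
    have hAtu : IsUnit ((A.map f)ᵀ).det := by rwa [Matrix.det_transpose]
    rw [hR, Matrix.transpose_mul, Matrix.transpose_nonsing_inv]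
    calc ((A.map f)ᵀ)⁻¹ * (C.map f)ᵀ
        = ((A.map f)ᵀ)⁻¹ * ((C.map f)ᵀ * A.map f) * (A.map f)⁻¹ := by
          rw [Matrix.mul_assoc, Matrix.mul_assoc, Matrix.mul_nonsing_inv _ hAu, Matrix.mul_one]
      _ = C.map f * (A.map f)⁻¹ := by
          rw [← h1', ← Matrix.mul_assoc, Matrix.nonsing_inv_mul _ hAtu, Matrix.one_mul]
  -- `W` consists of the nearest integers to the entries of `C A⁻¹`, and `R'` is the remainder
  set W : Matrix ν ν ℤ := Matrix.of fun i j => round (R i j) with hW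
  have hWsymm : Wᵀ = W := by
    ext i j
    have : R j i = R i j := congrFun (congrFun hRsymm i) j
    simp [hW, this]
  set R' : Matrix ν ν ℚ := R - W.map f with hR'
  have hR'symm : R'ᵀ = R' := by
    rw [hR', Matrix.transpose_sub, hRsymm, ← Matrix.transpose_map, hWsymm]
  have hR'A : R' * A.map f = (C - W * A).map f := by
    rw [hR', Matrix.sub_mul, hRA, Matrix.map_sub _ (map_sub f), Matrix.map_mul]
  have hsplit : Matrix.fromBlocks A B C D =
      Matrix.fromBlocks 1 0 W 1 * Matrix.fromBlocks A B (C - W * A) (D - W * B) := by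
    simp [Matrix.fromBlocks_multiply]
  have hM' : Matrix.fromBlocks A B (C - W * A) (D - W * B) ∈ Matrix.symplecticGroup ν ℤ := by
    have e : Matrix.fromBlocks A B (C - W * A) (D - W * B) =
        Matrix.fromBlocks 1 0 (-W) 1 * Matrix.fromBlocks A B C D := by
      simp [Matrix.fromBlocks_multiply, sub_eq_add_neg, add_comm]
    rw [e]
    exact mul_mem (fromBlocks_one_zero_mem_symplecticGroup (by simp [hWsymm])) hM
  rw [hsplit]
  refine mul_mem (hL W hWsymm) ?_
  generalize D - W * B = D' at hM' ⊢
  by_cases hR'0 : R' = 0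
  · -- a symplectic matrix whose lower left block vanishes
    have hC0 : C - W * A = 0 := by
      apply hfinj
      simp only
      rw [← hR'A, hR'0, Matrix.zero_mul, Matrix.map_zero _ (map_zero f)]
    rw [hC0] at hM' ⊢
    obtain ⟨-, h2, h3⟩ := SymplecticGroup.fromBlocks_mem_iff.mp hM'
    rw [Matrix.transpose_zero, Matrix.zero_mul, sub_zero] at h3
    have h4 : A * D'ᵀ = 1 := by
      rw [← Matrix.transpose_inj, Matrix.transpose_mul, Matrix.transpose_transpose,
        Matrix.transpose_one]
      exact mul_eq_one_comm.mp h3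
    have e : Matrix.fromBlocks A B 0 D' =
        Matrix.fromBlocks A 0 0 D' * Matrix.fromBlocks 1 (D'ᵀ * B) 0 1 := by
      simp [Matrix.fromBlocks_multiply, ← Matrix.mul_assoc, h4]
    rw [e]
    refine mul_mem (hU _ _ h4) (hT _ ?_)
    rw [Matrix.transpose_mul, Matrix.transpose_transpose, h2]
  · obtain ⟨E, hE, hE3, hdet0, hdet1⟩ := exists_partial_inversion hR'symm hR'0 fun i j => by
      simpa [hR', hW, hf] using abs_sub_round (R i j)
    generalize hC' : C - W * A = C' at hR'A hM' ⊢
    -- `M'` is multiplied by the partial inversion attached to `E`, a product of three unipotents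
    set M' := Matrix.fromBlocks A B C' D' with hM'def
    set G := Matrix.fromBlocks 1 (-E) 0 1 * (Matrix.fromBlocks 1 0 E 1 *
      (Matrix.fromBlocks 1 (-E) 0 1 * M')) with hG
    have hback : M' = Matrix.fromBlocks 1 E 0 1 * (Matrix.fromBlocks 1 0 (-E) 1 *
        (Matrix.fromBlocks 1 E 0 1 * G)) := by
      have c1 : Matrix.fromBlocks 1 E 0 1 * Matrix.fromBlocks 1 (-E) 0 1 =
          (1 : Matrix (ν ⊕ ν) (ν ⊕ ν) ℤ) := by
        simp [Matrix.fromBlocks_multiply]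
      have c2 : Matrix.fromBlocks 1 0 (-E) 1 * Matrix.fromBlocks 1 0 E 1 =
          (1 : Matrix (ν ⊕ ν) (ν ⊕ ν) ℤ) := by
        simp [Matrix.fromBlocks_multiply]
      rw [hG, ← Matrix.mul_assoc (Matrix.fromBlocks 1 E 0 1) (Matrix.fromBlocks 1 (-E) 0 1), c1,
        Matrix.one_mul, ← Matrix.mul_assoc (Matrix.fromBlocks 1 0 (-E) 1), c2, Matrix.one_mul,
        ← Matrix.mul_assoc, c1, Matrix.one_mul]
    have hGmem : G ∈ Matrix.symplecticGroup ν ℤ :=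
      mul_mem (fromBlocks_one_one_mem_symplecticGroup (by simp [hE]))
        (mul_mem (fromBlocks_one_zero_mem_symplecticGroup hE)
          (mul_mem (fromBlocks_one_one_mem_symplecticGroup (by simp [hE])) hM'))
    rw [hback]
    refine mul_mem (hT E hE) (mul_mem (hL (-E) (by simp [hE])) (mul_mem (hT E hE) ?_))
    obtain ⟨A₂, B₂, C₂, D₂, hblocks⟩ : ∃ A₂ B₂ C₂ D₂, G = Matrix.fromBlocks A₂ B₂ C₂ D₂ :=
      ⟨_, _, _, _, (Matrix.fromBlocks_toBlocks G).symm⟩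
    have hA₂ : A₂ = A - E * (E * A + C') := by
      rw [hG, hM'def, Matrix.fromBlocks_multiply, Matrix.fromBlocks_multiply,
        Matrix.fromBlocks_multiply, Matrix.fromBlocks_inj] at hblocks
      rw [← hblocks.1]
      have hE3' : E * (E * (E * C')) = E * C' := by
        rw [← Matrix.mul_assoc, ← Matrix.mul_assoc, hE3]
      simp only [Matrix.one_mul, Matrix.neg_mul, Matrix.zero_mul, zero_add, Matrix.mul_add,
        Matrix.mul_neg, hE3']
      abel
    have hA₂f : A₂.map f = (1 - E.map f * (E.map f + R')) * A.map f := by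
      rw [hA₂, Matrix.sub_mul, Matrix.one_mul, Matrix.mul_assoc, Matrix.add_mul, hR'A,
        Matrix.map_sub _ (map_sub f), Matrix.map_mul, Matrix.map_add _ (map_add f), Matrix.map_mul]
    have hdetA₂ : (A₂.det : ℚ) =
        (1 - E.map (Int.cast : ℤ → ℚ) * (E.map (Int.cast : ℤ → ℚ) + R')).det * A.det := by
      have h := congrArg Matrix.det hA₂f
      rw [Matrix.det_mul, ← RingHom.mapMatrix_apply, ← RingHom.map_det, ← RingHom.mapMatrix_apply f A,
        ← RingHom.map_det] at h
      exact h
    have hA' : (A.det : ℚ) ≠ 0 := by exact_mod_cast hA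
    have hlt : A₂.det.natAbs < N := by
      rw [← hN]
      zify
      have : |(A₂.det : ℚ)| < |(A.det : ℚ)| := by
        rw [hdetA₂, abs_mul]
        exact mul_lt_of_lt_one_left (abs_pos.mpr hA') hdet1
      exact_mod_cast this
    have hA₂0 : A₂.det ≠ 0 := by
      have : (A₂.det : ℚ) ≠ 0 := hdetA₂ ▸ mul_ne_zero hdet0 hA'
      exact_mod_cast this
    rw [hblocks]
    exact ih _ hlt A₂ B₂ C₂ D₂ (hblocks ▸ hGmem) hA₂0 rfl

theorem symplecticGroup_le_of_generators
    (hT : ∀ B : Matrix ν ν ℤ, Bᵀ = B → Matrix.fromBlocks 1 B 0 1 ∈ H)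
    (hL : ∀ B : Matrix ν ν ℤ, Bᵀ = B → Matrix.fromBlocks 1 0 B 1 ∈ H)
    (hU : ∀ U V : Matrix ν ν ℤ, U * Vᵀ = 1 → Matrix.fromBlocks U 0 0 V ∈ H) :
    Matrix.symplecticGroup ν ℤ ≤ H := by
  intro M hM
  obtain ⟨A, B, C, D, rfl⟩ : ∃ A B C D, M = Matrix.fromBlocks A B C D :=
    ⟨_, _, _, _, (Matrix.fromBlocks_toBlocks M).symm⟩
  obtain ⟨t, ht⟩ := exists_det_add_smul_ne_zero hM
  have e : Matrix.fromBlocks A B C D = Matrix.fromBlocks 1 (-((t : ℤ) • 1)) 0 1 *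
      Matrix.fromBlocks (A + (t : ℤ) • C) (B + (t : ℤ) • D) C D := by
    simp [Matrix.fromBlocks_multiply]
  have e' : Matrix.fromBlocks (A + (t : ℤ) • C) (B + (t : ℤ) • D) C D =
      Matrix.fromBlocks 1 ((t : ℤ) • 1) 0 1 * Matrix.fromBlocks A B C D := by
    simp [Matrix.fromBlocks_multiply]
  rw [e]
  refine mul_mem (hT _ (by simp)) (mem_of_det_ne_zero hT hL hU _ _ _ _ _ ?_ ht rfl)
  rw [e']
  exact mul_mem (fromBlocks_one_one_mem_symplecticGroup (by simp)) hM

end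

/-! ### Pluriharmonic polynomials as sums of powers of linear forms -/

section

variable {σ : Type*} [Fintype σ]

/-- The linear form with coefficient vector `w`, as a polynomial. -/
noncomputable def linForm (w : σ → ℂ) : MvPolynomial σ ℂ :=
  ∑ x, w x • MvPolynomial.X x

theorem eval_linForm (w v : σ → ℂ) : MvPolynomial.eval v (linForm w) = ∑ x, w x * v x := by
  simp [linForm, MvPolynomial.smul_eval]

theorem pderiv_linForm (w : σ → ℂ) (y : σ) :
    MvPolynomial.pderiv y (linForm w) = MvPolynomial.C (w y) := by
  classical
  simp [linForm, MvPolynomial.pderiv_X, Pi.single_apply, MvPolynomial.smul_eq_C_mul]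

/-- The `ℂ`-span of the `d`-th powers of linear forms. -/
noncomputable def linFormPowSpan (σ : Type*) [Fintype σ] (d : ℕ) :
    Submodule ℂ (MvPolynomial σ ℂ) :=
  Submodule.span ℂ (Set.range fun w : σ → ℂ => linForm w ^ d)

/-- The span of the powers of linear forms is stable under multiplication by a variable: a linear
functional that kills all `(ℓ + s X x) ^ (d + 1)` kills the coefficient of `s`, which is
`(d + 1) X x ℓ ^ d`. -/
theorem X_mul_mem_linFormPowSpan {d : ℕ} (x : σ) {p : MvPolynomial σ ℂ}
    (hp : p ∈ linFormPowSpan σ d) : MvPolynomial.X x * p ∈ linFormPowSpan σ (d + 1) := by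
  classical
  rw [linFormPowSpan] at hp
  induction hp using Submodule.span_induction with
  | zero => simp
  | add p q _ _ hp hq => rw [mul_add]; exact add_mem hp hq
  | smul c p _ hp => rw [mul_smul_comm]; exact Submodule.smul_mem _ _ hp
  | mem p hp =>
  obtain ⟨w, rfl⟩ := hp
  by_contra hmem
  obtain ⟨f, hf, hker⟩ := Submodule.exists_le_ker_of_notMem hmem
  apply hf
  set g : Polynomial ℂ := ∑ j ∈ Finset.range (d + 1 + 1),
    Polynomial.monomial j (f (MvPolynomial.X x ^ j * linForm w ^ (d + 1 - j) *
      ((d + 1).choose j : MvPolynomial σ ℂ))) with hg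
  have hg0 : g = 0 := by
    refine Polynomial.funext fun s => ?_
    have hlin : linForm (w + s • Pi.single x 1) = s • MvPolynomial.X x + linForm w := by
      simp [linForm, add_smul, Finset.sum_add_distrib, Pi.single_apply, add_comm]
    have h0 : f (linForm (w + s • Pi.single x 1) ^ (d + 1)) = 0 :=
      hker (Submodule.subset_span ⟨_, rfl⟩)
    rw [hlin, add_pow, map_sum] at h0
    rw [Polynomial.eval_zero, ← h0, hg, Polynomial.eval_finsetSum]
    refine Finset.sum_congr rfl fun j _ => ?_
    rw [Polynomial.eval_monomial, smul_pow, smul_mul_assoc, smul_mul_assoc, map_smul, smul_eq_mul,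
      mul_comm]
  have h1 := congrArg (fun q : Polynomial ℂ => q.coeff 1) hg0
  simp only [hg, Polynomial.finsetSum_coeff, Polynomial.coeff_monomial, Finset.sum_ite_eq',
    Finset.mem_range, Polynomial.coeff_zero] at h1
  rw [if_pos (by omega), pow_one, Nat.choose_one_right, mul_comm, ← nsmul_eq_mul, map_nsmul,
    Nat.add_sub_cancel, smul_eq_zero] at h1
  exact h1.resolve_left (Nat.succ_ne_zero d)

/-- Homogeneous polynomials of degree `d` are linear combinations of `d`-th powers of linear
forms. -/
theorem MvPolynomial.IsHomogeneous.mem_linFormPowSpan {P : MvPolynomial σ ℂ} {d : ℕ}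
    (hP : P.IsHomogeneous d) : P ∈ linFormPowSpan σ d := by
  have hpow : ∀ (x : σ) (e d : ℕ) (p : MvPolynomial σ ℂ), p ∈ linFormPowSpan σ d →
      MvPolynomial.X x ^ e * p ∈ linFormPowSpan σ (e + d) := by
    intro x e
    induction e with
    | zero => intro d p hp; simpa using hp
    | succ e ih =>
      intro d p hp
      rw [pow_succ', mul_assoc, add_right_comm]
      exact X_mul_mem_linFormPowSpan x (ih d p hp)
  have hmono : ∀ s : σ →₀ ℕ, MvPolynomial.monomial s (1 : ℂ) ∈ linFormPowSpan σ s.degree := by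
    intro s
    induction s using Finsupp.induction with
    | zero => exact Submodule.subset_span ⟨0, by simp⟩
    | single_add x e s _ _ ih =>
      have h := hpow x e _ _ ih
      rw [map_add, Finsupp.degree_single, MvPolynomial.monomial_single_add]
      exact h
  rw [P.as_sum]
  refine Submodule.sum_mem _ fun s hs => ?_
  have hd : s.degree = d := by
    have := hP (MvPolynomial.mem_support_iff.mp hs)
    rwa [Finsupp.degree_eq_weight_one]
  have e : MvPolynomial.monomial s (P.coeff s) = P.coeff s • MvPolynomial.monomial s (1 : ℂ) := by
    rw [MvPolynomial.smul_monomial, smul_eq_mul, mul_one]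
  rw [e, ← hd]
  exact Submodule.smul_mem _ _ (hmono s)

/-- The homogeneous second order differential operator with constant coefficients `G`. -/
noncomputable def secondOrderOp (G : σ → σ → ℂ) : MvPolynomial σ ℂ →ₗ[ℂ] MvPolynomial σ ℂ :=
  ∑ x, ∑ y, G x y • ((MvPolynomial.pderiv x).toLinearMap ∘ₗ (MvPolynomial.pderiv y).toLinearMap)

theorem secondOrderOp_apply (G : σ → σ → ℂ) (p : MvPolynomial σ ℂ) :
    secondOrderOp G p =
      ∑ x, ∑ y, G x y • MvPolynomial.pderiv x (MvPolynomial.pderiv y p) := by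
  simp [secondOrderOp, LinearMap.sum_apply]

theorem secondOrderOp_linForm_pow (G : σ → σ → ℂ) (w : σ → ℂ) (d : ℕ) :
    secondOrderOp G (linForm w ^ d) =
      ((d * (d - 1 : ℕ) : ℕ) : ℂ) • (∑ x, ∑ y, G x y * (w x * w y)) • linForm w ^ (d - 2) := by
  have h : ∀ (e : ℕ) (y : σ), MvPolynomial.pderiv y (linForm w ^ e) =
      ((e : ℂ) * w y) • linForm w ^ (e - 1) := by
    intro e y
    rw [Derivation.leibniz_pow, pderiv_linForm, smul_eq_mul, mul_comm, ← MvPolynomial.smul_eq_C_mul,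
      mul_smul, ← Nat.cast_smul_eq_nsmul ℂ]
  rw [secondOrderOp_apply, Finset.sum_smul, Finset.smul_sum]
  refine Finset.sum_congr rfl fun x _ => ?_
  rw [Finset.sum_smul, Finset.smul_sum]
  refine Finset.sum_congr rfl fun y _ => ?_
  rw [h, Derivation.map_smul, h, Nat.sub_sub, smul_smul, smul_smul, smul_smul]
  congr 1
  push_cast
  ring

/-- If a second order operator kills a sum of `d`-th powers of linear forms, then it also gives
relations between the lower powers, weighted by powers of its symbol. -/
theorem sum_symbol_pow_mul_linForm_pow_eq_zero {G : σ → σ → ℂ} {N d : ℕ} {a : Fin N → ℂ}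
    {w : Fin N → σ → ℂ} (h : secondOrderOp G (∑ r, a r • linForm (w r) ^ d) = 0) (j : ℕ) :
    1 ≤ j → 2 * j ≤ d →
      ∑ r, (a r * (∑ x, ∑ y, G x y * (w r x * w r y)) ^ j) • linForm (w r) ^ (d - 2 * j) = 0 := by
  have hstep : ∀ j, 2 * (j + 1) ≤ d → secondOrderOp G
      (∑ r, (a r * (∑ x, ∑ y, G x y * (w r x * w r y)) ^ j) • linForm (w r) ^ (d - 2 * j)) = 0 →
      ∑ r, (a r * (∑ x, ∑ y, G x y * (w r x * w r y)) ^ (j + 1)) •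
        linForm (w r) ^ (d - 2 * (j + 1)) = 0 := by
    intro j hj h0
    have hne : (((d - 2 * j) * (d - 2 * j - 1 : ℕ) : ℕ) : ℂ) ≠ 0 :=
      Nat.cast_ne_zero.mpr (Nat.mul_ne_zero (by omega) (by omega))
    refine (smul_eq_zero.mp ?_).resolve_left hne
    rw [← h0, map_sum, Finset.smul_sum]
    refine Finset.sum_congr rfl fun r _ => ?_
    rw [map_smul, secondOrderOp_linForm_pow, smul_smul, smul_smul, smul_smul, Nat.sub_sub]
    congr 1
    ring
  induction j with
  | zero => intro h; omega
  | succ j ih =>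
    intro _ hj
    refine hstep j hj ?_
    rcases Nat.eq_zero_or_pos j with rfl | hpos
    · simpa using h
    · rw [ih hpos (by omega), map_zero]

end

/-- A homogeneous pluriharmonic polynomial in the entries of an `m × n` matrix, pulled back along
`x ↦ z cᵀ S x`, is a pluriharmonic sum of powers. The linear form with coefficient matrix `W` pulls
back to the one with coefficient matrix `S c W`, and `S⁻¹` evaluated on `S c W` is `cᵀ S c` evaluated
on `W`. -/
theorem IsPluriharmonic.isPluriharmonicPowerSum {n m : ℕ} {ρ : Type*} [Fintype ρ] [DecidableEq ρ]
    {S : Matrix ρ ρ ℤ} (hSt : Sᵀ = S) (hSu : IsUnit S.det) {c : Matrix ρ (Fin m) ℤ}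
    (hc : IsUnit ((cᵀ * S * c).map (fun a : ℤ => (a : ℚ))).det)
    {P : MvPolynomial (Fin m × Fin n) ℂ} {d : ℕ} (hd : P.IsHomogeneous d)
    (hP : IsPluriharmonic (((cᵀ * S * c).map (fun a : ℤ => (a : ℚ)))⁻¹) P) (z : ℂ) :
    IsPluriharmonicPowerSum S d fun x : Matrix ρ (Fin n) ℂ =>
      evalMatrix P (z • (intToComplex (cᵀ * S) * x)) := by
  obtain ⟨N, a, g, hsum⟩ := Submodule.mem_span_set'.mp hd.mem_linFormPowSpan
  choose w hw using fun r => (g r).2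
  have hPw : P = ∑ r, a r • linForm (w r) ^ d := by
    rw [← hsum]
    exact Finset.sum_congr rfl fun r _ => by rw [← hw r]
  set T : Matrix (Fin m) (Fin m) ℂ := intToComplex (cᵀ * S * c) with hT
  set W : Fin N → Matrix (Fin m) (Fin n) ℂ := fun r => Matrix.of fun p i => w r (p, i) with hW
  have hlin : ∀ (r : Fin N) (X : Matrix (Fin m) (Fin n) ℂ),
      MvPolynomial.eval (fun x => X x.1 x.2) (linForm (w r)) = ((W r)ᵀ * X).trace := by
    intro r X
    rw [eval_linForm, Fintype.sum_prod_type, Finset.sum_comm]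
    simp [Matrix.trace, Matrix.mul_apply, hW]
  have htr : ∀ (r : Fin N) (x : Matrix ρ (Fin n) ℂ),
      ((intToComplex (S * c) * W r)ᵀ * x).trace = ((W r)ᵀ * (intToComplex (cᵀ * S) * x)).trace := by
    intro r x
    rw [Matrix.transpose_mul, ← intToComplex_transpose, Matrix.transpose_mul, hSt, Matrix.mul_assoc]
  have hSinv : (intToComplex S)⁻¹ * intToComplex S = 1 := by
    refine Matrix.nonsing_inv_mul _ ?_
    rw [det_intToComplex]
    exact hSu.map (Int.castRingHom ℂ)
  have hsymb : ∀ (r : Fin N) (Y : Matrix (Fin n) (Fin n) ℂ),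
      ((intToComplex S)⁻¹ * (intToComplex (S * c) * W r) * Y *
        (intToComplex (S * c) * W r)ᵀ).trace =
      ∑ x : Fin m × Fin n, ∑ y : Fin m × Fin n, T x.1 y.1 * Y y.2 x.2 * (w r x * w r y) := by
    intro r Y
    rw [Matrix.transpose_mul, ← intToComplex_transpose, Matrix.transpose_mul, hSt,
      intToComplex_mul S c, Matrix.mul_assoc (intToComplex S), ← Matrix.mul_assoc _ (intToComplex S),
      hSinv, Matrix.one_mul]
    have e : (intToComplex c * W r * Y * ((W r)ᵀ * intToComplex (cᵀ * S))).trace =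
        ((W r)ᵀ * (T * (W r * Y))).trace := by
      rw [Matrix.trace_mul_comm, hT, intToComplex_mul (cᵀ * S)]
      simp only [Matrix.mul_assoc]
    rw [e]
    simp only [Matrix.trace, Matrix.diag_apply, Matrix.mul_apply, Fintype.sum_prod_type,
      Finset.mul_sum, Matrix.transpose_apply, hW, Matrix.of_apply]
    rw [Finset.sum_comm]
    refine Finset.sum_congr rfl fun p _ => Finset.sum_congr rfl fun i _ =>
      Finset.sum_congr rfl fun q _ => Finset.sum_congr rfl fun j _ => ?_
    ring
  refine ⟨N, fun r => z ^ d * a r, fun r => intToComplex (S * c) * W r, fun x => ?_,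
    fun Y x j hj hjd => ?_⟩
  · change MvPolynomial.eval _ P = _
    rw [hPw, map_sum]
    refine Finset.sum_congr rfl fun r _ => ?_
    rw [MvPolynomial.smul_eval, map_pow, hlin, htr, Matrix.mul_smul, Matrix.trace_smul, smul_eq_mul,
      mul_pow]
    ring
  · have hG : secondOrderOp (fun x y : Fin m × Fin n => T x.1 y.1 * Y y.2 x.2) P = 0 := by
      have hTinv : ∀ p q, (((((cᵀ * S * c).map (fun a : ℤ => (a : ℚ)))⁻¹)⁻¹ p q : ℚ) : ℂ) =
          T p q := by
        intro p q
        rw [Matrix.nonsing_inv_nonsing_inv _ hc]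
        simp [hT, intToComplex]
      calc secondOrderOp (fun x y : Fin m × Fin n => T x.1 y.1 * Y y.2 x.2) P
          = ∑ i, ∑ j, Y j i • pluriLaplacian (((cᵀ * S * c).map (fun a : ℤ => (a : ℚ)))⁻¹) i j P := by
            simp only [secondOrderOp_apply, pluriLaplacian, hTinv, Fintype.sum_prod_type,
              Finset.smul_sum, smul_smul]
            rw [Finset.sum_comm]
            refine Finset.sum_congr rfl fun i _ => ?_
            refine (Finset.sum_congr rfl fun p _ => Finset.sum_comm).trans (Finset.sum_comm.trans ?_)
            refine Finset.sum_congr rfl fun j _ => Finset.sum_congr rfl fun p _ =>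
              Finset.sum_congr rfl fun q _ => ?_
            rw [mul_comm]
        _ = 0 := Finset.sum_eq_zero fun i _ => Finset.sum_eq_zero fun j _ => by
            rw [hP i j, smul_zero]
    rw [hPw] at hG
    have h := congrArg (MvPolynomial.eval fun y : Fin m × Fin n => (intToComplex (cᵀ * S) * x) y.1 y.2)
      (sum_symbol_pow_mul_linForm_pow_eq_zero hG j hj hjd)
    rw [map_sum, map_zero] at h
    simp only [hsymb, htr]
    rw [← mul_zero (z ^ d), ← h, Finset.mul_sum]
    refine Finset.sum_congr rfl fun r _ => ?_
    rw [MvPolynomial.smul_eval, map_pow, hlin]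
    ring

/-! ### The transformation law of the theta series -/

theorem mainTheorem3 (n m k : ℕ) (hn : 0 < n) (hm : 0 < m) (hk : 0 < k)
    (S : Matrix (Fin (2 * k)) (Fin (2 * k)) ℤ) (hS : IsEvenUnimodularPosDef S)
    (c : Matrix (Fin (2 * k)) (Fin m) ℤ)
    (hc : ((cᵀ * S * c).map (fun a : ℤ => (a : ℝ))).PosDef)
    (P : MvPolynomial (Fin m × Fin n) ℂ) (d : ℕ) (hPhom : P.IsHomogeneous d)
    (hP : IsPluriharmonic (((cᵀ * S * c).map (fun a : ℤ => (a : ℚ)))⁻¹) P)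
    (M : Matrix (Fin n ⊕ Fin n) (Fin n ⊕ Fin n) ℤ)
    (hM : M ∈ Matrix.symplecticGroup (Fin n) ℤ)
    (Z : Matrix (Fin n) (Fin n) ℂ) (hZ : Z ∈ SiegelUpperHalf n) :
    IsUnit (siegelDenom M Z).det ∧
    (Summable fun L : Matrix (Fin (2 * k)) (Fin n) ℤ =>
      evalMatrix P ((2 * Real.pi * Complex.I : ℂ) •
          (intToComplex (cᵀ * S * L) * ((siegelDenom M Z)⁻¹)ᵀ)) *
        Complex.exp (Real.pi * Complex.I *
          (intToComplex (S * L) * (siegelNum M Z * (siegelDenom M Z)⁻¹) *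
            intToComplex Lᵀ).trace)) ∧
    (Summable fun L : Matrix (Fin (2 * k)) (Fin n) ℤ =>
      evalMatrix P ((2 * Real.pi * Complex.I : ℂ) • intToComplex (cᵀ * S * L)) *
        Complex.exp (Real.pi * Complex.I *
          (intToComplex (S * L) * Z * intToComplex Lᵀ).trace)) ∧
    (∑' L : Matrix (Fin (2 * k)) (Fin n) ℤ,
      evalMatrix P ((2 * Real.pi * Complex.I : ℂ) •
          (intToComplex (cᵀ * S * L) * ((siegelDenom M Z)⁻¹)ᵀ)) *
        Complex.exp (Real.pi * Complex.I *
          (intToComplex (S * L) * (siegelNum M Z * (siegelDenom M Z)⁻¹) *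
            intToComplex Lᵀ).trace)) =
    (siegelDenom M Z).det ^ k *
      ∑' L : Matrix (Fin (2 * k)) (Fin n) ℤ,
        evalMatrix P ((2 * Real.pi * Complex.I : ℂ) • intToComplex (cᵀ * S * L)) *
          Complex.exp (Real.pi * Complex.I *
            (intToComplex (S * L) * Z * intToComplex Lᵀ).trace) := by
  classical
  have hSt : Sᵀ = S := by
    ext i j
    have := congrFun (congrFun hS.posDef.isHermitian i) j
    simpa using this
  have hcard : Fintype.card (Fin (2 * k)) = 2 * k := Fintype.card_fin _
  have hk2 : Even k := even_of_posDef_unimodular hS.posDef hSt hS.unimodular hS.even hcard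
  have hlaw : ThetaLaw S k M :=
    symplecticGroup_le_of_generators (H := thetaSubmonoid S k n)
      (fun _ hB => ThetaLaw.translation hSt hS.even k hB)
      (fun _ hB => ThetaLaw.lower hS.posDef hSt hS.unimodular hS.even hcard hk2 hB)
      (fun _ _ hUV => ThetaLaw.levi hk2 hUV) hM
  have hcu : IsUnit ((cᵀ * S * c).map (fun a : ℤ => (a : ℚ))).det := by
    have h1 : (cᵀ * S * c).det ≠ 0 := by
      intro h0
      have h2 := hc.det_pos
      have h3 : ((cᵀ * S * c).map (fun a : ℤ => (a : ℝ))).det = (((cᵀ * S * c).det : ℤ) : ℝ) :=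
        ((Int.castRingHom ℝ).map_det _).symm
      rw [h3, h0, Int.cast_zero] at h2
      exact lt_irrefl _ h2
    have h3 : ((cᵀ * S * c).map (fun a : ℤ => (a : ℚ))).det = (((cᵀ * S * c).det : ℤ) : ℚ) :=
      ((Int.castRingHom ℚ).map_det _).symm
    rw [isUnit_iff_ne_zero, h3]
    exact Int.cast_ne_zero.mpr h1
  have hQ := IsPluriharmonic.isPluriharmonicPowerSum hSt hS.unimodular hcu hPhom hP
    (2 * Real.pi * Complex.I)
  obtain ⟨hu, hs, hsum⟩ := hlaw Z hZ
  have h1 := (hQ.comp_mul_right ((siegelDenom M Z)⁻¹)ᵀ).summable hS.posDef hSt hs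
  have h2 := hQ.summable hS.posDef hSt hZ
  have h3 := hsum d _ hQ
  simp only [← Matrix.mul_assoc (intToComplex (cᵀ * S)), ← intToComplex_mul] at h1 h2 h3
  exact ⟨hu, h1, h2, h3⟩
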